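/- Let $p=\{p(x):x\in\mathbb Z\}$ be a probability kernel with $\sum_x e^{\theta x}p(x)<\infty$ for all $|\theta|\le\delta$, for some $\delta>0$; put $v=\sum_x x\,p(x)$ and $\kappa_2=\sum_x x^2p(x)$, and assume $\kappa_2>0$. For each integer $n\ge 1$ let $\eta_0^n(m)$, $m\in\mathbb Z$, be i.i.d. $\{0,1,2,\dots\}$-valued random variables whose law does not depend on $n$, and let $X^n_{m,j}(\cdot)$, $m\in\mathbb Z$, $j\ge1$, be continuous-time random walks with $X^n_{m,j}(0)=m$ and jump rates $p$ (total jump rate $1$), such that the processes $X^n_{m,j}(\cdot)-m$ are i.i.d. and independent of $\eta_0^n$. Fix $t>0$ and $r\in\mathbb R$. With $[\cdot]$ the integer part, let $$Y_n(t,r)=\sum_{m\in\mathbb Z}\sum_{j=1}^{\eta_0^n(m)}\Bigl[\mathbf 1\{X^n_{m,j}(nt)\le[nvt]+[r\sqrt n]\}\mathbf 1\{m>[r\sqrt n]\}-\mathbf 1\{X^n_{m,j}(nt)>[nvt]+[r\sqrt n]\}\mathbf 1\{m\le[r\sqrt n]\}\Bigr].$$ Let $\Phi=\Phi_{\kappa_2t}$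 be the distribution function of the centered Gaussian law with variance $\kappa_2t$, let $\gamma(\theta)=\log E e^{\theta\eta_0^n(0)}$, let $$Z_\lambda(y)=\begin{cases}\log\{\Phi(y)+e^{\lambda}(1-\Phi(y))\},&y>0,\\ \log\{e^{-\lambda}\Phi(y)+1-\Phi(y)\},&y\le0,\end{cases}$$ and $\Lambda(\lambda)=\int_{-\infty}^\infty\gamma(Z_\lambda(y))\,dy$. We say that $I:\mathbb R\to[0,\infty)$ is *the rate function of the current* if the random variables $n^{-1/2}Y_n(t,r)$ satisfy the large deviation principle with normalization $\sqrt n$ and rate function $I$, that is, $$\limsup_{n\to\infty}\tfrac1{\sqrt n}\log P\{n^{-1/2}Y_n(t,r)\in F\}\le-\inf_{F}I,\qquad \liminf_{n\to\infty}\tfrac1{\sqrt n}\log P\{n^{-1/2}Y_n(t,r)\in G\}\ge-\inf_{G}I$$ for all closed $F\subset\mathbb R$ and all open $G\subset\mathbb R$; all level sets $\{I\le c\}$ are compact; and $I$ is the convex dual of $\Lambda$: the integral defining $\Lambda(\lambda)$ converges absolutely for every $\lambda\in\mathbb R$, and $I(x)=\sup_{\lambda\in\mathbb R}\{\lambda x-\Lambda(\lambda)\}$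 for every $x\in\mathbb R$. 1. If $\eta_0^n(m)\sim\mathrm{Poisson}(\rho)$ with $\rho>0$, then the rate function of the current is $$I(x)=x\log\biggl(\frac{x\sqrt\pi}{\rho\sqrt{2\kappa_2t}}+\sqrt{1+\frac{\pi x^2}{2\rho^2\kappa_2t}}\biggr)-\rho\sqrt{\frac{2\kappa_2t}{\pi}}\biggl(\sqrt{1+\frac{\pi x^2}{2\rho^2\kappa_2t}}-1\biggr),\qquad x\in\mathbb R.$$ 2. If $\eta_0^n(m)=1$ almost surely for all $m$ and $n$, put $$F_\alpha(y)=\frac{e^{-\alpha}\Phi(y)}{1-\Phi(y)+e^{-\alpha}\Phi(y)},\qquad \alpha,y\in\mathbb R.$$ Then $1-F_\alpha$ is integrable on $(0,\infty)$ and $F_\alpha$ on $(-\infty,0]$ for every $\alpha$; for every $x\in\mathbb R$ there is exactly one $\alpha(x)\in\mathbb R$ with $$x=\int_0^\infty\bigl(1-F_{\alpha(x)}(y)\bigr)\,dy-\int_{-\infty}^0F_{\alpha(x)}(y)\,dy;$$ and the rate function of the current is $$I(x)=\int_{-\infty}^\infty\biggl[\bigl(1-F_{\alpha(x)}(y)\bigr)\log\frac{1-F_{\alpha(x)}(y)}{1-\Phi(y)}+F_{\alpha(x)}(y)\log\frac{F_{\alpha(x)}(y)}{\Phi(y)}\biggr]dy,\qquad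 x\in\mathbb R,$$ the integral being absolutely convergent for every $x$. -/

import Mathlib

open MeasureTheory ProbabilityTheory Filter Topology Set
open scoped NNReal ENNReal

noncomputable section

namespace WalkCurrent

/-! ### The random walk kernel -/

/-- The kernel has exponential moments: `∑ₓ e^{θx} p(x) < ∞` for all `|θ| ≤ δ`, for some `δ > 0`. -/
def HasExpMoments (p : PMF ℤ) : Prop :=
  ∃ δ : ℝ, 0 < δ ∧ ∀ θ : ℝ, |θ| ≤ δ →
    Summable fun x : ℤ => Real.exp (θ * (x : ℝ)) * (p x).toReal

/-- The mean `v = ∑ₓ x p(x)`. -/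
def drift (p : PMF ℤ) : ℝ := ∑' x : ℤ, (x : ℝ) * (p x).toReal

/-- The second moment `κ₂ = ∑ₓ x² p(x)`. -/
def secondMoment (p : PMF ℤ) : ℝ := ∑' x : ℤ, (x : ℝ) ^ 2 * (p x).toReal

/-- Law of the sum of `k` independent steps with law `p`. -/
def stepSumLaw (p : PMF ℤ) (k : ℕ) : Measure ℤ :=
  (Measure.pi fun _ : Fin k => p.toMeasure).map fun s => ∑ i, s i

/-- Law of the displacement over a time interval of length `s` of the continuous-time random walk
with jump rates `p`: the number of jumps is Poisson with mean `s`, and given that there are `k`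
jumps, the displacement is the sum of `k` independent steps with law `p`. -/
def displacementLaw (p : PMF ℤ) (s : ℝ≥0) : Measure ℤ :=
  (poissonMeasure s).bind (stepSumLaw p)

/-- `ξ` is a continuous-time random walk on `ℤ` with jump rates `p`, started at the origin:
independent increments, stationary with the law above, and càdlàg paths (which for integer-valued
paths means locally constant to the right and eventually constant from the left). -/
structure IsRandomWalk {Ω : Type*} [MeasurableSpace Ω] (p : PMF ℤ) (P : Measure Ω)
    (ξ : ℝ≥0 → Ω → ℤ) : Prop where
  measurable : ∀ s, Measurable (ξ s)
  start : ∀ᵐ ω ∂P, ξ 0 ω = 0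
  indep_increments : HasIndepIncrements ξ P
  law_increments : ∀ s h : ℝ≥0,
    P.map (fun ω => ξ (s + h) ω - ξ s ω) = displacementLaw p h
  cadlag : ∀ᵐ ω ∂P, ∀ s : ℝ≥0,
    (∀ᶠ u in 𝓝[>] s, ξ u ω = ξ s ω) ∧ ∃ k : ℤ, ∀ᶠ u in 𝓝[<] s, ξ u ω = k

/-! ### The particle system and its current -/

/-- A system of independent random walks with i.i.d. initial occupation variables `η m`
(`m ∈ ℤ`) of common law `ν`. The position at time `s` of the `j`-th particle started from
site `m` is `m + ξ (m, j) s`; the particles at `m` are labelled `j = 0, …, η m - 1`. The walks are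
i.i.d. and independent of the initial occupations. -/
structure IsWalkSystem {Ω : Type*} [MeasurableSpace Ω] (p : PMF ℤ) (ν : Measure ℕ)
    (P : Measure Ω) (η : ℤ → Ω → ℕ) (ξ : ℤ × ℕ → ℝ≥0 → Ω → ℤ) : Prop where
  measurable_occ : ∀ m, Measurable (η m)
  law_occ : ∀ m, P.map (η m) = ν
  indep_occ : iIndepFun η P
  walk : ∀ a, IsRandomWalk p P (ξ a)
  indep_walks : iIndepFun (fun a ω => fun s : ℝ≥0 => ξ a s ω) P
  indep_occ_walks :
    IndepFun (fun ω => fun m : ℤ => η m ω) (fun ω => fun (a : ℤ × ℕ) (s : ℝ≥0) => ξ a s ω) P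

/-- The net right-to-left current `Y_n(t, r)` during `[0, nt]` across the characteristic line
started at `⌊r √n⌋`: particles that start to the right of `⌊r √n⌋` and are at time `nt`
at or to the left of `⌊n v t⌋ + ⌊r √n⌋` count `+1`, those that start at or to the left and end to
the right count `-1`. -/
def current {Ω : Type*} (p : PMF ℤ) (η : ℤ → Ω → ℕ) (ξ : ℤ × ℕ → ℝ≥0 → Ω → ℤ)
    (n : ℕ) (t : ℝ≥0) (r : ℝ) (ω : Ω) : ℝ :=
  ∑' m : ℤ, ∑ j ∈ Finset.range (η m ω),
    ((if m + ξ (m, j) (n * t) ω ≤ ⌊(n : ℝ) * drift p * t⌋ + ⌊r * √(n : ℝ)⌋ ∧ ⌊r * √(n : ℝ)⌋ < m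
        then (1 : ℝ) else 0)
      - (if ⌊(n : ℝ) * drift p * t⌋ + ⌊r * √(n : ℝ)⌋ < m + ξ (m, j) (n * t) ω ∧ m ≤ ⌊r * √(n : ℝ)⌋
        then (1 : ℝ) else 0))

/-! ### Large deviations -/

/-- The real random variables `X n` satisfy the large deviation principle with normalization `√n`
and rate function `J`. -/
def SatisfiesLDP {Ω : ℕ → Type*} [∀ n, MeasurableSpace (Ω n)] (P : ∀ n, Measure (Ω n))
    (X : ∀ n, Ω n → ℝ) (J : ℝ → EReal) : Prop :=
  (∀ F : Set ℝ, IsClosed F →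
    limsup (fun n : ℕ => ((1 / √(n : ℝ) : ℝ) : EReal) * ENNReal.log (P n (X n ⁻¹' F))) atTop
      ≤ -⨅ x ∈ F, J x) ∧
  (∀ G : Set ℝ, IsOpen G →
    -⨅ x ∈ G, J x ≤
      liminf (fun n : ℕ => ((1 / √(n : ℝ) : ℝ) : EReal) * ENNReal.log (P n (X n ⁻¹' G))) atTop)

/-- A good rate function: nonnegative, with compact level sets. -/
def IsGoodRate (J : ℝ → EReal) : Prop :=
  (∀ x, 0 ≤ J x) ∧ ∀ c : ℝ, IsCompact {x | J x ≤ (c : EReal)}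

/-- The centered Gaussian distribution function `Φ_{σ²}`, as a function of the variance. -/
def Phi (σsq : ℝ) (y : ℝ) : ℝ := cdf (gaussianReal 0 σsq.toNNReal) y

/-- `γ(θ) = log E e^{θ η}` for an occupation variable `η` of law `ν`. -/
def gam (ν : Measure ℕ) (θ : ℝ) : ℝ := cgf (fun k : ℕ => (k : ℝ)) ν θ

/-- The function `Z_l(y)`, where `σsq` stands for `κ₂ t`. -/
def Zfun (σsq l y : ℝ) : ℝ :=
  if 0 < y then Real.log (Phi σsq y + Real.exp l * (1 - Phi σsq y))
  else Real.log (Real.exp (-l) * Phi σsq y + 1 - Phi σsq y)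

/-- `Λ(l) = ∫ γ(Z_l(y)) dy`. -/
def Lam (ν : Measure ℕ) (σsq l : ℝ) : ℝ := ∫ y : ℝ, gam ν (Zfun σsq l y)

/-- `I` is the convex dual of `Λ`: `Λ` is given everywhere by a convergent integral, and
`I(x) = sup_l (l x - Λ(l))`, a finite supremum, for every real `x`. -/
def IsDualOfLam (ν : Measure ℕ) (σsq : ℝ) (I : ℝ → ℝ) : Prop :=
  (∀ l : ℝ, Integrable fun y : ℝ => gam ν (Zfun σsq l y)) ∧
  ∀ x : ℝ, IsLUB (range fun l : ℝ => l * x - Lam ν σsq l) (I x)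

/-- `I` is the rate function of the scaled currents `n^{-1/2} Y_n(t, r)`: they satisfy the large
deviation principle with normalization `√n` and good rate function `I`, and `I` is the convex dual
of `Λ`. -/
def IsCurrentRate {Ω : ℕ → Type*} [∀ n, MeasurableSpace (Ω n)] (p : PMF ℤ) (ν : Measure ℕ)
    (P : ∀ n, Measure (Ω n)) (η : ∀ n, ℤ → Ω n → ℕ) (ξ : ∀ n, ℤ × ℕ → ℝ≥0 → Ω n → ℤ)
    (t : ℝ≥0) (r : ℝ) (I : ℝ → ℝ) : Prop :=
  SatisfiesLDP P (fun n ω => current p (η n) (ξ n) n t r ω / √(n : ℝ)) (fun x => (I x : EReal)) ∧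
  IsGoodRate (fun x => (I x : EReal)) ∧
  IsDualOfLam ν (secondMoment p * t) I

/-! ### The explicit rate functions -/

/-- The rate function for Poisson(`ρ`) occupations, where `σsq` stands for `κ₂ t`. -/
def poissonRate (ρ σsq x : ℝ) : ℝ :=
  x * Real.log (x * √Real.pi / (ρ * √(2 * σsq)) + √(1 + x ^ 2 * Real.pi / (2 * ρ ^ 2 * σsq)))
    - ρ * √(2 * σsq / Real.pi) * (√(1 + x ^ 2 * Real.pi / (2 * ρ ^ 2 * σsq)) - 1)

/-- The tilted distribution function `F_a`. -/
def Ftilt (σsq a y : ℝ) : ℝ :=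
  Real.exp (-a) * Phi σsq y / (1 - Phi σsq y + Real.exp (-a) * Phi σsq y)

/-- The mean current `∫_0^∞ (1 - F_a) dy - ∫_{-∞}^0 F_a dy` under the tilting parameter `a`. -/
def tiltedCurrent (σsq a : ℝ) : ℝ :=
  (∫ y in Ioi (0 : ℝ), (1 - Ftilt σsq a y)) - ∫ y in Iic (0 : ℝ), Ftilt σsq a y

/-- The relative entropy density at `y` of Bernoulli(`F_a(y)`) with respect to
Bernoulli(`Φ(y)`). -/
def entropyDensity (σsq a y : ℝ) : ℝ :=
  (1 - Ftilt σsq a y) * Real.log ((1 - Ftilt σsq a y) / (1 - Phi σsq y))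
    + Ftilt σsq a y * Real.log (Ftilt σsq a y / Phi σsq y)

end WalkCurrent

end

namespace WalkCurrent

/-! ### A one-dimensional Gärtner–Ellis theorem -/

/-! Shift space so that the characteristic starts at the origin. A particle started at relative
position `k` can then contribute to the current only with the sign of its own side, and it does so
exactly when it crosses. So the current is a signed sum of crossing counts, independent from site to
site. Conditioning on the occupations gives the cumulant generating function exactly: it is `∑ₖ g(1
+ (e^{±l} - 1) q_n(k))`, where `g(u) = log E u^η` and `q_n(k)` is the crossing probability
(`IsMarkedSystem.cgf_tsum_signed_hits`).

Divided by `√n`, this sum is the integral of a step function in `y`, with `k = ⌈√n y⌉`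
(`IsWalkSystem.cgf_current`). The central limit theorem gives `q_n(⌈√n y⌉) → 1 - Φ(|y|)`
(`tendsto_crossProb`), and a tail estimate dominates `q_n` by `C / (1 + y²)` uniformly in `n ≥ 1`
(`crossProb_le`). Dominated convergence then yields the limit `Λ(l)`.

In both cases `Λ` is differentiable with a monotone derivative mapping onto `ℝ`, so every `x` is
`Λ'(l)` for some tilt `l`. A Gärtner–Ellis argument (`satisfiesLDP_of_tendsto_cgf`) therefore gives
the full large deviation principle, and the dual is `l Λ'(l) - Λ(l)` at `x = Λ'(l)`. What remains is
explicit. For Poisson occupations `Λ` is a multiple of `cosh l - 1`. For one particle per site `Λ'`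
is the tilted mean current, and `l Λ'(l) - Λ(l)` is the integrated relative entropy. -/

lemma tangent_le_of_monotone_deriv {L L' : ℝ → ℝ} (hL : ∀ l, HasDerivAt L (L' l) l)
    (hmono : Monotone L') (l m : ℝ) : L l + L' l * (m - l) ≤ L m := by
  have hderiv : deriv L = L' := funext fun l => (hL l).deriv
  have hconv : ConvexOn ℝ univ L :=
    Monotone.convexOn_univ_of_deriv (fun l => (hL l).differentiableAt) (hderiv ▸ hmono)
  rcases lt_trichotomy l m with h | h | h
  · have := hconv.le_slope_of_hasDerivAt (mem_univ l) (mem_univ m) h (hL l)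
    rw [slope_def_field, le_div_iff₀ (by linarith)] at this
    linarith
  · simp [h]
  · have := hconv.slope_le_of_hasDerivAt (mem_univ m) (mem_univ l) h (hL l)
    rw [slope_def_field, div_le_iff₀ (by linarith)] at this
    linarith

lemma isLUB_dual_of_deriv {L L' : ℝ → ℝ} (hL : ∀ l, HasDerivAt L (L' l) l)
    (hmono : Monotone L') (l : ℝ) :
    IsLUB (range fun m : ℝ => m * L' l - L m) (l * L' l - L l) := by
  refine ⟨?_, fun b hb => hb ⟨l, rfl⟩⟩
  rintro _ ⟨m, rfl⟩
  have := tangent_le_of_monotone_deriv hL hmono l m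
  simp only
  linarith

lemma isGoodRate_of_isLUB {L I : ℝ → ℝ} (h0 : L 0 = 0)
    (hI : ∀ x, IsLUB (range fun l : ℝ => l * x - L l) (I x)) :
    IsGoodRate (fun x => (I x : EReal)) := by
  have hle : ∀ l x, l * x - L l ≤ I x := fun l x => (hI x).1 ⟨l, rfl⟩
  refine ⟨fun x => ?_, fun c => ?_⟩
  · have := hle 0 x
    simp only [h0, zero_mul, sub_zero] at this
    exact EReal.coe_nonneg.2 this
  · have hset : {x | (I x : EReal) ≤ (c : EReal)} = ⋂ l : ℝ, {x | l * x - L l ≤ c} := by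
      ext x
      simp only [mem_ofPred_eq, EReal.coe_le_coe_iff, mem_iInter]
      refine ⟨fun h l => (hle l x).trans h, fun h => (hI x).2 ?_⟩
      rintro _ ⟨l, rfl⟩
      exact h l
    have hclosed : IsClosed {x | (I x : EReal) ≤ (c : EReal)} := by
      rw [hset]
      exact isClosed_iInter fun l => isClosed_le (by fun_prop) continuous_const
    -- The slopes `l = 1` and `l = -1` alone already confine the level set to a bounded interval.
    refine (isCompact_Icc (a := -(c + L (-1))) (b := c + L 1)).of_isClosed_subset hclosed ?_
    intro x hx
    have hx' : I x ≤ c := EReal.coe_le_coe_iff.1 hx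
    have h1 := hle 1 x
    have h2 := hle (-1) x
    constructor <;> linarith

section LDP

variable {Ω : Type*} [MeasurableSpace Ω] {μ : Measure Ω} [IsProbabilityMeasure μ] {Y : Ω → ℝ}

/-- Chernoff's bound under the tilt `l`, written without changing measure. Off the ball, either `Y -
a ≥ d` or `Y - a ≤ -d`, and raising or lowering the exponent by `s` pays for the deviation.
Rearranged, it bounds the probability of the ball from below by moment generating functions only. -/
lemma mgf_le_ball_add_tails (hY : AEMeasurable Y μ)
    (hint : ∀ l, Integrable (fun ω => Real.exp (l * Y ω)) μ) (l s a d : ℝ) (hs : 0 ≤ s) :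
    mgf Y μ l ≤ Real.exp (l * a + |l| * d) * μ.real {ω | |Y ω - a| < d}
      + Real.exp (-s * (a + d)) * mgf Y μ (l + s) + Real.exp (s * (a - d)) * mgf Y μ (l - s) := by
  have hS : NullMeasurableSet {ω | |Y ω - a| < d} μ :=
    nullMeasurableSet_lt (by fun_prop) (by fun_prop)
  have hi1 : Integrable ({ω | |Y ω - a| < d}.indicator
      fun _ => Real.exp (l * a + |l| * d)) μ := (integrable_const _).indicator₀ hS
  have hi2 := (hint (l + s)).const_mul (Real.exp (-s * (a + d)))
  have hi3 := (hint (l - s)).const_mul (Real.exp (s * (a - d)))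
  have key : mgf Y μ l ≤ ∫ ω, ({ω | |Y ω - a| < d}.indicator
      (fun _ => Real.exp (l * a + |l| * d)) ω
      + Real.exp (-s * (a + d)) * Real.exp ((l + s) * Y ω)
      + Real.exp (s * (a - d)) * Real.exp ((l - s) * Y ω)) ∂μ := by
    refine integral_mono (hint l) ((hi1.add hi2).add hi3) fun ω => ?_
    simp only [← Real.exp_add]
    by_cases hω : |Y ω - a| < d
    · rw [indicator_of_mem (by exact hω)]
      have h1 : l * (Y ω - a) ≤ |l| * d := (le_abs_self _).trans (by rw [abs_mul]; gcongr)
      have h2 : Real.exp (l * Y ω) ≤ Real.exp (l * a + |l| * d) :=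
        Real.exp_le_exp.2 (by linarith)
      have h3 := Real.exp_pos (-s * (a + d) + (l + s) * Y ω)
      have h4 := Real.exp_pos (s * (a - d) + (l - s) * Y ω)
      linarith
    · rw [indicator_of_notMem (by exact hω), zero_add]
      have h3 := Real.exp_pos (-s * (a + d) + (l + s) * Y ω)
      have h4 := Real.exp_pos (s * (a - d) + (l - s) * Y ω)
      rcases le_abs.1 (not_lt.1 hω) with h | h
      · have : Real.exp (l * Y ω) ≤ Real.exp (-s * (a + d) + (l + s) * Y ω) :=
          Real.exp_le_exp.2 (by nlinarith)
        linarith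
      · have : Real.exp (l * Y ω) ≤ Real.exp (s * (a - d) + (l - s) * Y ω) :=
          Real.exp_le_exp.2 (by nlinarith)
        linarith
  refine key.trans_eq ?_
  refine (integral_add (hi1.add hi2) hi3).trans ?_
  rw [Pi.add_def, integral_add hi1 hi2, integral_indicator₀ hS, integral_const_mul,
    integral_const_mul, setIntegral_const, smul_eq_mul, mul_comm (μ.real _)]
  rfl

end LDP

lemma scaled_log_le {N b : ℝ} (hN : 0 < N) {m : ℝ≥0∞}
    (h : m ≤ ENNReal.ofReal (Real.exp (-(N * b)))) :
    ((1 / N : ℝ) : EReal) * ENNReal.log m ≤ ((-b : ℝ) : EReal) := by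
  have h1 : ENNReal.log m ≤ ((-(N * b) : ℝ) : EReal) := by
    refine (ENNReal.log_le_log h).trans ?_
    rw [ENNReal.log_ofReal_of_pos (Real.exp_pos _), Real.log_exp]
  calc ((1 / N : ℝ) : EReal) * ENNReal.log m
      ≤ ((1 / N : ℝ) : EReal) * ((-(N * b) : ℝ) : EReal) :=
        mul_le_mul_of_nonneg_left h1 (by exact_mod_cast (by positivity : (0:ℝ) ≤ 1 / N))
    _ = ((-b : ℝ) : EReal) := by
        rw [← EReal.coe_mul]; congr 1; field_simp

lemma le_scaled_log {N b : ℝ} (hN : 0 < N) {m : ℝ≥0∞}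
    (h : ENNReal.ofReal (Real.exp (-(N * b))) ≤ m) :
    ((-b : ℝ) : EReal) ≤ ((1 / N : ℝ) : EReal) * ENNReal.log m := by
  have h1 : ((-(N * b) : ℝ) : EReal) ≤ ENNReal.log m := by
    refine le_trans ?_ (ENNReal.log_le_log h)
    rw [ENNReal.log_ofReal_of_pos (Real.exp_pos _), Real.log_exp]
  calc ((-b : ℝ) : EReal) = ((1 / N : ℝ) : EReal) * ((-(N * b) : ℝ) : EReal) := by
        rw [← EReal.coe_mul]; congr 1; field_simp
    _ ≤ _ := mul_le_mul_of_nonneg_left h1 (by exact_mod_cast (by positivity : (0:ℝ) ≤ 1 / N))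

lemma tendsto_sqrt_natCast_atTop : Tendsto (fun n : ℕ => √(n : ℝ)) atTop atTop :=
  Real.tendsto_sqrt_atTop.comp tendsto_natCast_atTop_atTop

section GartnerEllis

variable {Ω : ℕ → Type*} [∀ n, MeasurableSpace (Ω n)] {P : ∀ n, Measure (Ω n)}
  [∀ n, IsProbabilityMeasure (P n)] {Y : ∀ n, Ω n → ℝ} {L L' I : ℝ → ℝ}

lemma eventually_upper_tail_le
    (hint : ∀ᶠ n in atTop, ∀ l, Integrable (fun ω => Real.exp (l * Y n ω)) (P n))
    (hlim : ∀ l, Tendsto (fun n : ℕ => cgf (Y n) (P n) l / √(n : ℝ)) atTop (𝓝 (L l)))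
    {l x b : ℝ} (hl : 0 ≤ l) (hb : b < l * x - L l) :
    ∀ᶠ n : ℕ in atTop, P n {ω | x ≤ Y n ω / √(n : ℝ)} ≤ ENNReal.ofReal (Real.exp (-(√n * b))) := by
  have h1 := (hlim l).eventually (gt_mem_nhds (show L l < l * x - b by linarith))
  filter_upwards [hint, h1, eventually_gt_atTop 0] with n hn hlt hpos
  have hN : 0 < √(n : ℝ) := Real.sqrt_pos.2 (by exact_mod_cast hpos)
  have h2 := measure_ge_le_exp_cgf (μ := P n) (X := Y n) (x * √(n : ℝ)) hl (hn l)
  rw [div_lt_iff₀ hN] at hlt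
  have hset : {ω | x ≤ Y n ω / √(n : ℝ)} = {ω | x * √(n : ℝ) ≤ Y n ω} := by
    ext ω; simp only [mem_ofPred_eq, le_div_iff₀ hN]
  rw [hset, ← ofReal_measureReal]
  refine ENNReal.ofReal_le_ofReal (h2.trans (Real.exp_le_exp.2 ?_))
  nlinarith

lemma eventually_lower_tail_le
    (hint : ∀ᶠ n in atTop, ∀ l, Integrable (fun ω => Real.exp (l * Y n ω)) (P n))
    (hlim : ∀ l, Tendsto (fun n : ℕ => cgf (Y n) (P n) l / √(n : ℝ)) atTop (𝓝 (L l)))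
    {l x b : ℝ} (hl : l ≤ 0) (hb : b < l * x - L l) :
    ∀ᶠ n : ℕ in atTop, P n {ω | Y n ω / √(n : ℝ) ≤ x} ≤ ENNReal.ofReal (Real.exp (-(√n * b))) := by
  have h1 := (hlim l).eventually (gt_mem_nhds (show L l < l * x - b by linarith))
  filter_upwards [hint, h1, eventually_gt_atTop 0] with n hn hlt hpos
  have hN : 0 < √(n : ℝ) := Real.sqrt_pos.2 (by exact_mod_cast hpos)
  have h2 := measure_le_le_exp_cgf (μ := P n) (X := Y n) (x * √(n : ℝ)) hl (hn l)
  rw [div_lt_iff₀ hN] at hlt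
  have hset : {ω | Y n ω / √(n : ℝ) ≤ x} = {ω | Y n ω ≤ x * √(n : ℝ)} := by
    ext ω; simp only [mem_ofPred_eq, div_le_iff₀ hN]
  rw [hset, ← ofReal_measureReal]
  refine ENNReal.ofReal_le_ofReal (h2.trans (Real.exp_le_exp.2 ?_))
  nlinarith

/-- Under the tilt `l` with `L'(l) = x`, the mass concentrates near `x`: since `L` has slope `x` at
`l`, a small shift `s` makes both tail terms exponentially smaller than the total. Undoing the tilt
costs `l x - L l`, up to the radius of the ball. -/
lemma eventually_le_ball
    (hY : ∀ᶠ n in atTop, AEMeasurable (Y n) (P n))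
    (hint : ∀ᶠ n in atTop, ∀ l, Integrable (fun ω => Real.exp (l * Y n ω)) (P n))
    (hlim : ∀ l, Tendsto (fun n : ℕ => cgf (Y n) (P n) l / √(n : ℝ)) atTop (𝓝 (L l)))
    {l x b d : ℝ} (hL : HasDerivAt L x l) (hd : 0 < d) (hb : l * x - L l < b) :
    ∀ᶠ n : ℕ in atTop, ENNReal.ofReal (Real.exp (-(√n * b))) ≤
      P n {ω | |Y n ω / √(n : ℝ) - x| < d} := by
  -- A smaller ball is used so that the oscillation `|l| d'` of the exponent over it still fits
  -- below `b`.
  obtain ⟨d', hd'0, hd'd, hd'b⟩ : ∃ d', 0 < d' ∧ d' ≤ d ∧ l * x - L l + |l| * d' < b := by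
    have : Tendsto (fun d' => l * x - L l + |l| * d') (𝓝[>] 0) (𝓝 (l * x - L l + |l| * 0)) :=
      (Continuous.tendsto (by fun_prop) 0).mono_left nhdsWithin_le_nhds
    have h1 := this.eventually (gt_mem_nhds (by simpa using hb))
    have h2 : ∀ᶠ d' in 𝓝[>] (0:ℝ), d' ∈ Ioc 0 d := Ioc_mem_nhdsGT hd
    obtain ⟨d', h1, h2⟩ := (h1.and h2).exists
    exact ⟨d', h2.1, h2.2, h1⟩
  obtain ⟨s, hs0, hs1, hs2⟩ : ∃ s, 0 < s ∧ L (l + s) < L l + s * (x + d') ∧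
      L (l - s) < L l - s * (x - d') := by
    have h0 := (hasDerivAt_iff_isLittleO.1 hL).def (c := d' / 2) (by positivity)
    have hp : Tendsto (fun s : ℝ => l + s) (𝓝[>] 0) (𝓝 l) := by
      have := (Continuous.tendsto (f := fun s : ℝ => l + s) (by fun_prop) 0).mono_left
        (nhdsWithin_le_nhds (s := Ioi 0))
      simpa using this
    have hm : Tendsto (fun s : ℝ => l - s) (𝓝[>] 0) (𝓝 l) := by
      have := (Continuous.tendsto (f := fun s : ℝ => l - s) (by fun_prop) 0).mono_left
        (nhdsWithin_le_nhds (s := Ioi 0))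
      simpa using this
    obtain ⟨s, h1, h2, hs⟩ :=
      ((hp.eventually h0).and ((hm.eventually h0).and self_mem_nhdsWithin)).exists
    have hs : 0 < s := hs
    simp only [Real.norm_eq_abs, add_sub_cancel_left, smul_eq_mul, sub_sub_cancel_left, abs_neg,
      abs_of_pos hs] at h1 h2
    refine ⟨s, hs, ?_, ?_⟩
    · have := (abs_le.1 h1).2; nlinarith
    · have := (abs_le.1 h2).2; nlinarith
  -- The margin `3 * e` serves as follows: one `e` is lost in the convergence at `l ± s`, leaving
  -- tails of at most `exp (N (L l - 2 e))`. The convergence at `l` loses another, so the total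
  -- exceeds a tail by a factor `exp (N e)`. Once this factor is at least 3, the total minus the two
  -- tails still leaves one such term for the ball.
  obtain ⟨e, he0, he1, he2, he3⟩ : ∃ e, 0 < e ∧ L (l + s) + 3 * e < L l + s * (x + d') ∧
      L (l - s) + 3 * e < L l - s * (x - d') ∧ l * x - L l + |l| * d' + 2 * e < b := by
    refine ⟨min (min ((L l + s * (x + d') - L (l + s)) / 4) ((L l - s * (x - d') - L (l - s)) / 4))
      ((b - (l * x - L l + |l| * d')) / 3), ?_, ?_, ?_, ?_⟩
    · refine lt_min (lt_min ?_ ?_) ?_ <;> linarith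
    · have := (min_le_left (min ((L l + s * (x + d') - L (l + s)) / 4)
        ((L l - s * (x - d') - L (l - s)) / 4))
        ((b - (l * x - L l + |l| * d')) / 3)).trans (min_le_left _ _)
      linarith
    · have := (min_le_left (min ((L l + s * (x + d') - L (l + s)) / 4)
        ((L l - s * (x - d') - L (l - s)) / 4))
        ((b - (l * x - L l + |l| * d')) / 3)).trans (min_le_right _ _)
      linarith
    · have := min_le_right (min ((L l + s * (x + d') - L (l + s)) / 4)
        ((L l - s * (x - d') - L (l - s)) / 4)) ((b - (l * x - L l + |l| * d')) / 3)
      linarith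
  have h1 := (hlim l).eventually (lt_mem_nhds (show L l - e < L l by linarith))
  have h2 := (hlim (l + s)).eventually (gt_mem_nhds (show L (l + s) < L (l + s) + e by linarith))
  have h3 := (hlim (l - s)).eventually (gt_mem_nhds (show L (l - s) < L (l - s) + e by linarith))
  have h4 : ∀ᶠ n : ℕ in atTop, 3 ≤ Real.exp (√(n : ℝ) * e) :=
    (Real.tendsto_exp_atTop.comp
      (tendsto_sqrt_natCast_atTop.atTop_mul_const he0)).eventually_ge_atTop 3
  filter_upwards [hY, hint, h1, h2, h3, h4, eventually_gt_atTop 0] with n hYn hn h1 h2 h3 h4 hpos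
  have hN : 0 < √(n : ℝ) := Real.sqrt_pos.2 (by exact_mod_cast hpos)
  set N := √(n : ℝ)
  rw [lt_div_iff₀ hN] at h1
  rw [div_lt_iff₀ hN] at h2 h3
  have key := mgf_le_ball_add_tails hYn hn l s (N * x) (N * d') hs0.le
  rw [← exp_cgf (hn l), ← exp_cgf (hn (l + s)), ← exp_cgf (hn (l - s)), ← Real.exp_add,
    ← Real.exp_add] at key
  have hset : {ω | |Y n ω - N * x| < N * d'} ⊆ {ω | |Y n ω / N - x| < d} := by
    intro ω hω
    have hω : |Y n ω - N * x| < N * d' := hω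
    have : Y n ω / N - x = (Y n ω - N * x) / N := by field_simp
    change |Y n ω / N - x| < d
    rw [this, abs_div, abs_of_pos hN, div_lt_iff₀ hN]
    nlinarith
  have hp := measureReal_mono hset (h₂ := measure_ne_top (P n) _)
  rw [← ofReal_measureReal]
  refine ENNReal.ofReal_le_ofReal (le_trans ?_ hp)
  set q := (P n).real {ω | |Y n ω - N * x| < N * d'}
  have k1 : Real.exp (-s * (N * x + N * d') + cgf (Y n) (P n) (l + s))
      ≤ Real.exp (N * (L l - 2 * e)) := Real.exp_le_exp.2 (by nlinarith)
  have k2 : Real.exp (s * (N * x - N * d') + cgf (Y n) (P n) (l - s))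
      ≤ Real.exp (N * (L l - 2 * e)) := Real.exp_le_exp.2 (by nlinarith)
  have k3 : Real.exp (N * (L l - 2 * e)) * Real.exp (N * e) ≤ Real.exp (cgf (Y n) (P n) l) := by
    rw [← Real.exp_add]
    exact Real.exp_le_exp.2 (by nlinarith)
  have k4 := Real.exp_pos (N * (L l - 2 * e))
  have k5 : Real.exp (N * (L l - 2 * e)) ≤ Real.exp (l * (N * x) + |l| * (N * d')) * q := by
    nlinarith
  have k6 : Real.exp (-(N * b)) * Real.exp (l * (N * x) + |l| * (N * d'))
      ≤ Real.exp (N * (L l - 2 * e)) := by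
    rw [← Real.exp_add]
    exact Real.exp_le_exp.2 (by nlinarith)
  have k7 := Real.exp_pos (l * (N * x) + |l| * (N * d'))
  refine le_of_mul_le_mul_right (k6.trans (k5.trans_eq (mul_comm _ _))) k7

/-- Surjectivity of `L'` makes every point exposed, so the local lower bound applies at each point
of an open set. For a closed set, its nearest points on either side of the limiting mean `L' 0` are
themselves values `L' l`, and the Chernoff bound with that `l` controls the whole side. -/
theorem satisfiesLDP_of_tendsto_cgf
    (hY : ∀ᶠ n in atTop, AEMeasurable (Y n) (P n))
    (hint : ∀ᶠ n in atTop, ∀ l, Integrable (fun ω => Real.exp (l * Y n ω)) (P n))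
    (hlim : ∀ l, Tendsto (fun n : ℕ => cgf (Y n) (P n) l / √(n : ℝ)) atTop (𝓝 (L l)))
    (hL : ∀ l, HasDerivAt L (L' l) l) (hmono : Monotone L') (hsurj : Function.Surjective L')
    (h0 : L 0 = 0) (hI : ∀ x, IsLUB (range fun l : ℝ => l * x - L l) (I x)) :
    SatisfiesLDP P (fun n ω => Y n ω / √(n : ℝ)) (fun x => (I x : EReal)) := by
  have hIval : ∀ l, I (L' l) = l * L' l - L l := fun l =>
    (hI (L' l)).unique (isLUB_dual_of_deriv hL hmono l)
  refine ⟨fun F hF => ?_, fun G hG => ?_⟩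
  · refine le_of_forall_gt_imp_ge_of_dense fun c hc => ?_
    obtain ⟨c', hc'1, hc'2⟩ := EReal.lt_iff_exists_real_btwn.1 hc
    refine le_trans ?_ hc'2.le
    obtain ⟨b, hb⟩ : ∃ b : ℝ, c' = -b := ⟨-c', by simp⟩
    subst hb
    have hbI : ∀ x ∈ F, b < I x := by
      intro x hx
      have : ((b : ℝ) : EReal) < ⨅ x ∈ F, (I x : EReal) := by
        have := EReal.neg_lt_neg_iff.2 hc'1
        simpa using this
      exact_mod_cast this.trans_le (iInf₂_le x hx)
    refine limsup_le_of_le (by isBoundedDefault) ?_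
    have hNpos : ∀ᶠ n : ℕ in atTop, 0 < √(n : ℝ) := by
      filter_upwards [eventually_gt_atTop 0] with n hn
      exact Real.sqrt_pos.2 (by exact_mod_cast hn)
    rcases lt_or_ge b 0 with hb0 | hb0
    · filter_upwards [hNpos] with n hN
      refine scaled_log_le hN (prob_le_one.trans ?_)
      rw [← ENNReal.ofReal_one]
      exact ENNReal.ofReal_le_ofReal (Real.one_le_exp (by nlinarith))
    · -- A strictly larger level, to absorb the factor two.
      obtain ⟨b', hb'1, hb'2⟩ : ∃ b' : ℝ, b < b' ∧ ∀ x ∈ F, b' < I x := by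
        have : ((b : ℝ) : EReal) < ⨅ x ∈ F, (I x : EReal) := by
          have := EReal.neg_lt_neg_iff.2 hc'1
          simpa using this
        obtain ⟨b', h1, h2⟩ := EReal.lt_iff_exists_real_btwn.1 this
        exact ⟨b', by exact_mod_cast h1, fun x hx => by
          exact_mod_cast h2.trans_le (iInf₂_le x hx)⟩
      -- The rate vanishes at the limiting mean, so a closed set with nonnegative level `b` strictly
      -- below its rates avoids it.
      have hx0 : L' 0 ∉ F := fun h => by
        have := hbI _ h
        rw [hIval 0, h0] at this
        linarith
      have hup : ∀ᶠ n : ℕ in atTop, P n {ω | Y n ω / √(n : ℝ) ∈ F ∩ Ici (L' 0)}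
          ≤ ENNReal.ofReal (Real.exp (-(√n * b'))) := by
        rcases (F ∩ Ici (L' 0)).eq_empty_or_nonempty with he | hne
        · simp [he]
        · have hcl : IsClosed (F ∩ Ici (L' 0)) := hF.inter isClosed_Ici
          have hbdd : BddBelow (F ∩ Ici (L' 0)) := ⟨L' 0, fun x hx => hx.2⟩
          have hmem := hcl.csInf_mem hne hbdd
          obtain ⟨l, hl⟩ := hsurj (sInf (F ∩ Ici (L' 0)))
          have hlt : L' 0 < L' l := by
            rw [hl]
            exact lt_of_le_of_ne hmem.2 fun h => hx0 (h ▸ hmem.1)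
          have hl0 : 0 ≤ l := by
            by_contra! h
            exact absurd (hmono h.le) (not_le.2 hlt)
          have hb'' := hb'2 _ hmem.1
          rw [← hl, hIval] at hb''
          filter_upwards [eventually_upper_tail_le hint hlim hl0 hb''] with n hn
          refine le_trans (measure_mono fun ω hω => ?_) hn
          exact hl.trans_le (csInf_le hbdd hω)
      have hdown : ∀ᶠ n : ℕ in atTop, P n {ω | Y n ω / √(n : ℝ) ∈ F ∩ Iic (L' 0)}
          ≤ ENNReal.ofReal (Real.exp (-(√n * b'))) := by
        rcases (F ∩ Iic (L' 0)).eq_empty_or_nonempty with he | hne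
        · simp [he]
        · have hcl : IsClosed (F ∩ Iic (L' 0)) := hF.inter isClosed_Iic
          have hbdd : BddAbove (F ∩ Iic (L' 0)) := ⟨L' 0, fun x hx => hx.2⟩
          have hmem := hcl.csSup_mem hne hbdd
          obtain ⟨l, hl⟩ := hsurj (sSup (F ∩ Iic (L' 0)))
          have hlt : L' l < L' 0 := by
            rw [hl]
            exact lt_of_le_of_ne hmem.2 fun h => hx0 (h ▸ hmem.1)
          have hl0 : l ≤ 0 := by
            by_contra! h
            exact absurd (hmono h.le) (not_le.2 hlt)
          have hb'' := hb'2 _ hmem.1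
          rw [← hl, hIval] at hb''
          filter_upwards [eventually_lower_tail_le hint hlim hl0 hb''] with n hn
          refine le_trans (measure_mono fun ω hω => ?_) hn
          exact (le_csSup hbdd hω).trans_eq hl.symm
      have h2 : ∀ᶠ n : ℕ in atTop, 2 ≤ Real.exp (√(n : ℝ) * (b' - b)) :=
        (Real.tendsto_exp_atTop.comp (tendsto_sqrt_natCast_atTop.atTop_mul_const
          (sub_pos.2 hb'1))).eventually_ge_atTop 2
      filter_upwards [hNpos, hup, hdown, h2] with n hN hup hdown h2
      refine scaled_log_le hN ?_
      calc P n ((fun ω => Y n ω / √(n : ℝ)) ⁻¹' F)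
          ≤ P n ({ω | Y n ω / √(n : ℝ) ∈ F ∩ Ici (L' 0)}
              ∪ {ω | Y n ω / √(n : ℝ) ∈ F ∩ Iic (L' 0)}) := by
            refine measure_mono fun ω hω => ?_
            rcases le_total (L' 0) (Y n ω / √(n : ℝ)) with h | h
            · exact Or.inl ⟨hω, h⟩
            · exact Or.inr ⟨hω, h⟩
        _ ≤ _ := (measure_union_le _ _).trans (add_le_add hup hdown)
        _ = ENNReal.ofReal (2 * Real.exp (-(√n * b'))) := by
            rw [two_mul, ENNReal.ofReal_add (Real.exp_pos _).le (Real.exp_pos _).le]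
        _ ≤ _ := by
            refine ENNReal.ofReal_le_ofReal ?_
            have : Real.exp (-(√n * b)) = Real.exp (√(n : ℝ) * (b' - b)) * Real.exp (-(√n * b')) := by
              rw [← Real.exp_add]; congr 1; ring
            rw [this]
            gcongr
  · rw [EReal.neg_le]
    refine le_iInf₂ fun x hx => ?_
    rw [EReal.neg_le]
    refine le_of_forall_lt_imp_le_of_dense fun c hc => ?_
    obtain ⟨c', hc'1, hc'2⟩ := EReal.lt_iff_exists_real_btwn.1 hc
    refine hc'1.le.trans ?_
    obtain ⟨b, rfl⟩ : ∃ b : ℝ, c' = -b := ⟨-c', by simp⟩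
    obtain ⟨l, rfl⟩ := hsurj x
    have hb : I (L' l) < b := by
      have : ((-b : ℝ) : EReal) < ((-(I (L' l)) : ℝ) : EReal) := by simpa using hc'2
      have := EReal.coe_lt_coe_iff.1 this
      linarith
    rw [hIval] at hb
    obtain ⟨d, hd, hball⟩ := Metric.isOpen_iff.1 hG _ hx
    refine le_liminf_of_le (by isBoundedDefault) ?_
    filter_upwards [eventually_le_ball hY hint hlim (hL l) hd hb, eventually_gt_atTop 0]
      with n hn hpos
    refine le_scaled_log (Real.sqrt_pos.2 (by exact_mod_cast hpos)) (hn.trans (measure_mono ?_))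
    intro ω hω
    exact hball (by simpa [Metric.mem_ball, Real.dist_eq] using hω)

end GartnerEllis

/-! ### The displacement law -/

lemma measurable_of_int {α : Type*} [MeasurableSpace α] (f : ℤ → α) : Measurable f :=
  measurable_from_top

instance isProbabilityMeasure_stepSumLaw (p : PMF ℤ) (k : ℕ) :
    IsProbabilityMeasure (stepSumLaw p k) :=
  Measure.isProbabilityMeasure_map (Measurable.aemeasurable (by fun_prop))

/-- The laws of the sums of steps, as a kernel. -/
noncomputable def stepSumKernel (p : PMF ℤ) : Kernel ℕ ℤ := ⟨stepSumLaw p, measurable_from_top⟩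

instance isMarkovKernel_stepSumKernel (p : PMF ℤ) : IsMarkovKernel (stepSumKernel p) :=
  ⟨fun k => isProbabilityMeasure_stepSumLaw p k⟩

/-- As a marginal of number of jumps and displacement jointly, the law becomes accessible to Fubini.
-/
lemma displacementLaw_eq_snd (p : PMF ℤ) (s : ℝ≥0) :
    displacementLaw p s = ((poissonMeasure s).compProd (stepSumKernel p)).snd := by
  rw [Measure.snd_compProd]; rfl

instance isProbabilityMeasure_displacementLaw (p : PMF ℤ) (s : ℝ≥0) :
    IsProbabilityMeasure (displacementLaw p s) := by
  rw [displacementLaw_eq_snd]; infer_instance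

/-- The characteristic function of one step. -/
noncomputable def stepChar (p : PMF ℤ) (u : ℝ) : ℂ :=
  ∫ x : ℤ, Complex.exp (u * x * Complex.I) ∂p.toMeasure

lemma norm_cexp_mul_mul_I (u : ℝ) (x : ℤ) : ‖Complex.exp (u * x * Complex.I)‖ = 1 := by
  have := Complex.norm_exp_ofReal_mul_I (u * x)
  push_cast at this
  exact this

lemma integrable_cexp {μ : Measure ℤ} [IsFiniteMeasure μ] (u : ℝ) :
    Integrable (fun x : ℤ => Complex.exp (u * x * Complex.I)) μ :=
  (integrable_const (1 : ℝ)).mono' (measurable_of_int _).aestronglyMeasurable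
    (ae_of_all _ fun x => (norm_cexp_mul_mul_I u x).le)

lemma integral_cexp_stepSumLaw (p : PMF ℤ) (k : ℕ) (u : ℝ) :
    ∫ x : ℤ, Complex.exp (u * x * Complex.I) ∂stepSumLaw p k = stepChar p u ^ k := by
  rw [stepSumLaw, integral_map (Measurable.aemeasurable (by fun_prop))
    (measurable_of_int _).aestronglyMeasurable, stepChar]
  have := integral_fintype_prod_eq_pow (ι := Fin k) (μ := p.toMeasure)
    (fun x : ℤ => Complex.exp (u * x * Complex.I))
  rw [Fintype.card_fin] at this
  rw [← this]
  congr 1 with s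
  rw [← Complex.exp_sum]
  push_cast
  rw [Finset.mul_sum, Finset.sum_mul]

lemma integral_cexp_displacementLaw (p : PMF ℤ) (s : ℝ≥0) (u : ℝ) :
    ∫ x : ℤ, Complex.exp (u * x * Complex.I) ∂displacementLaw p s
      = Complex.exp (s * (stepChar p u - 1)) := by
  have hint : Integrable (fun z : ℕ × ℤ => Complex.exp (u * z.2 * Complex.I))
      ((poissonMeasure s).compProd (stepSumKernel p)) :=
    (integrable_const (1 : ℝ)).mono'
      ((measurable_of_int (fun x : ℤ => Complex.exp (u * x * Complex.I))).comp
        measurable_snd).aestronglyMeasurable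
      (ae_of_all _ fun z => (norm_cexp_mul_mul_I u z.2).le)
  rw [displacementLaw_eq_snd, Measure.snd, integral_map (by fun_prop)
    (measurable_of_int _).aestronglyMeasurable, Measure.integral_compProd hint]
  change ∫ k, ∫ x : ℤ, Complex.exp (u * x * Complex.I) ∂stepSumLaw p k ∂_ = _
  simp_rw [integral_cexp_stepSumLaw]
  rw [integral_poissonMeasure]
  have hexp := NormedSpace.expSeries_div_hasSum_exp (𝔸 := ℂ) (s * stepChar p u)
  rw [← Complex.exp_eq_exp_ℂ] at hexp
  have h2 := hexp.mul_left (Complex.exp (-s))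
  rw [← Complex.exp_add] at h2
  rw [show (s : ℂ) * (stepChar p u - 1) = -s + s * stepChar p u by ring, ← h2.tsum_eq]
  congr 1 with k
  rw [Complex.real_smul, mul_pow]
  push_cast
  ring

/-! ### Second order expansion of the characteristic function -/

/-- A divergent `tsum` has value `0`, so positivity of the second moment already forces summability.
-/
lemma summable_secondMoment {p : PMF ℤ} (hκ : 0 < secondMoment p) :
    Summable fun x : ℤ => (x : ℝ) ^ 2 * (p x).toReal := by
  by_contra h
  rw [secondMoment, tsum_eq_zero_of_not_summable h] at hκ
  exact lt_irrefl _ hκ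

lemma integrable_toMeasure_of_summable {E : Type*} [NormedAddCommGroup E] {p : PMF ℤ} {f : ℤ → E}
    (h : Summable fun x => ‖f x‖ * (p x).toReal) : Integrable f p.toMeasure := by
  rw [← Measure.sum_smul_dirac p.toMeasure, integrable_sum_dirac_iff (fun i => measure_ne_top _ _)]
  refine h.congr fun x => ?_
  rw [PMF.toMeasure_apply_singleton _ _ (measurableSet_singleton x), mul_comm]

lemma integrable_sq {p : PMF ℤ} (hκ : 0 < secondMoment p) :
    Integrable (fun x : ℤ => (x : ℝ) ^ 2) p.toMeasure :=
  integrable_toMeasure_of_summable (by simpa using summable_secondMoment hκ)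

lemma integrable_cast {p : PMF ℤ} (hκ : 0 < secondMoment p) :
    Integrable (fun x : ℤ => (x : ℝ)) p.toMeasure := by
  refine (integrable_sq hκ).mono' (measurable_of_int _).aestronglyMeasurable
    (ae_of_all _ fun x => ?_)
  rw [Real.norm_eq_abs]
  -- Integers satisfy `|x| ≤ x²`, so the second moment dominates the first.
  exact_mod_cast Int.natAbs_le_self_sq x |>.trans_eq' (by simp)

lemma integral_sq {p : PMF ℤ} (hκ : 0 < secondMoment p) :
    ∫ x : ℤ, (x : ℝ) ^ 2 ∂p.toMeasure = secondMoment p := by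
  rw [PMF.integral_eq_tsum _ _ (integrable_sq hκ), secondMoment]
  simp_rw [smul_eq_mul, mul_comm]

lemma integral_cast {p : PMF ℤ} (hκ : 0 < secondMoment p) :
    ∫ x : ℤ, (x : ℝ) ∂p.toMeasure = drift p := by
  rw [PMF.integral_eq_tsum _ _ (integrable_cast hκ), drift]
  simp_rw [smul_eq_mul, mul_comm]

/-- The Taylor remainder `e^{ix} - 1 - ix`. -/
noncomputable def expRem (x : ℝ) : ℂ := Complex.exp (x * Complex.I) - 1 - x * Complex.I

/-- A single quadratic bound valid for all `x`. It is the dominating function for the expansion of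
the characteristic function and also the source of the tail estimate. -/
lemma norm_expRem_le (x : ℝ) : ‖expRem x‖ ≤ 3 * x ^ 2 := by
  have hn : ‖(x : ℂ) * Complex.I‖ = |x| := by simp
  rcases le_total |x| 1 with h | h
  · have := Complex.norm_exp_sub_one_sub_id_le (x := x * Complex.I) (by rwa [hn])
    rw [hn, sq_abs] at this
    refine this.trans (by nlinarith [sq_nonneg x])
  · calc ‖expRem x‖ ≤ ‖Complex.exp (x * Complex.I)‖ + ‖(1 : ℂ)‖ + ‖(x : ℂ) * Complex.I‖ :=
          (norm_sub_le _ _).trans (add_le_add_left (norm_sub_le _ _) _)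
      _ = 1 + 1 + |x| := by rw [Complex.norm_exp_ofReal_mul_I, hn, norm_one]
      _ ≤ 3 * |x| ^ 2 := by nlinarith
      _ = 3 * x ^ 2 := by rw [sq_abs]

lemma norm_expRem_add_le {x : ℝ} (h : |x| ≤ 1) : ‖expRem x + x ^ 2 / 2‖ ≤ |x| ^ 3 := by
  have hn : ‖(x : ℂ) * Complex.I‖ = |x| := by simp
  have := Complex.exp_bound (x := x * Complex.I) (by rwa [hn]) (n := 3) (by norm_num)
  rw [hn] at this
  have h2 : expRem x + x ^ 2 / 2
      = Complex.exp (x * Complex.I)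
        - ∑ m ∈ Finset.range 3, (x * Complex.I) ^ m / (m.factorial : ℂ) := by
    simp only [expRem, Finset.sum_range_succ, Finset.sum_range_zero, Nat.factorial]
    push_cast
    have hI := Complex.I_sq
    ring_nf
    rw [hI]
    ring
  rw [h2]
  refine this.trans ?_
  have h3 : ((Nat.succ 3 : ℕ) : ℝ) * ((Nat.factorial 3 : ℕ) * (3 : ℕ) : ℝ)⁻¹ ≤ 1 := by
    norm_num [Nat.factorial]
  nlinarith [pow_nonneg (abs_nonneg x) 3]

lemma tendsto_expRem_div (x : ℝ) :
    Tendsto (fun w : ℝ => expRem (w * x) / (w : ℂ) ^ 2) (𝓝[≠] 0) (𝓝 (-(x : ℂ) ^ 2 / 2)) := by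
  rw [tendsto_iff_norm_sub_tendsto_zero]
  have hlim : Tendsto (fun w : ℝ => |w| * |x| ^ 3) (𝓝[≠] 0) (𝓝 0) := by
    have : Tendsto (fun w : ℝ => |w| * |x| ^ 3) (𝓝 0) (𝓝 (|0| * |x| ^ 3)) :=
      Continuous.tendsto (by fun_prop) 0
    simpa using this.mono_left nhdsWithin_le_nhds
  have hsmall : ∀ᶠ w : ℝ in 𝓝[≠] 0, |w * x| ≤ 1 := by
    have : Tendsto (fun w : ℝ => |w * x|) (𝓝 0) (𝓝 (|0 * x|)) :=
      Continuous.tendsto (by fun_prop) 0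
    exact nhdsWithin_le_nhds (this.eventually (ge_mem_nhds (by simp)))
  refine squeeze_zero' (Eventually.of_forall fun _ => norm_nonneg _) ?_ hlim
  filter_upwards [hsmall, self_mem_nhdsWithin] with w hw hw0
  have hw0 : w ≠ 0 := hw0
  have hwc : (w : ℂ) ≠ 0 := by exact_mod_cast hw0
  have h1 := norm_expRem_add_le hw
  have h2 : expRem (w * x) / (w : ℂ) ^ 2 - -(x : ℂ) ^ 2 / 2
      = (expRem (w * x) + ((w * x : ℝ) : ℂ) ^ 2 / 2) / (w : ℂ) ^ 2 := by
    push_cast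
    field_simp
    ring
  rw [h2, norm_div, norm_pow, Complex.norm_real, Real.norm_eq_abs,
    div_le_iff₀ (by positivity)]
  refine h1.trans_eq ?_
  rw [abs_mul]; ring

/-- The remainder `φ(w) - 1 - i w v` of the characteristic function of one step. -/
noncomputable def charRem (p : PMF ℤ) (w : ℝ) : ℂ :=
  stepChar p w - 1 - w * drift p * Complex.I

lemma charRem_eq_integral {p : PMF ℤ} (hκ : 0 < secondMoment p) (w : ℝ) :
    charRem p w = ∫ x : ℤ, expRem (w * x) ∂p.toMeasure := by
  have h1 : Integrable (fun x : ℤ => Complex.exp (((w * x : ℝ) : ℂ) * Complex.I)) p.toMeasure := by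
    simpa using integrable_cexp (μ := p.toMeasure) w
  have h2 : Integrable (fun x : ℤ => ((w * x : ℝ) : ℂ) * Complex.I) p.toMeasure :=
    ((integrable_cast hκ).const_mul w).ofReal.mul_const _
  simp only [expRem]
  refine Eq.trans ?_ (integral_sub (h1.sub (integrable_const (1 : ℂ))) h2).symm
  rw [Pi.sub_def, integral_sub h1 (integrable_const _), integral_mul_const,
    integral_complex_ofReal, integral_const_mul, integral_cast hκ,
    integral_const, charRem, stepChar]
  simp

lemma norm_charRem_le {p : PMF ℤ} (hκ : 0 < secondMoment p) (w : ℝ) :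
    ‖charRem p w‖ ≤ 3 * secondMoment p * w ^ 2 := by
  rw [charRem_eq_integral hκ]
  refine (norm_integral_le_of_norm_le ((integrable_sq hκ).const_mul (3 * w ^ 2))
    (ae_of_all _ fun x => (norm_expRem_le _).trans_eq (by ring))).trans_eq ?_
  rw [integral_const_mul, integral_sq hκ]; ring

lemma tendsto_charRem_div {p : PMF ℤ} (hκ : 0 < secondMoment p) :
    Tendsto (fun w : ℝ => charRem p w / (w : ℂ) ^ 2) (𝓝[≠] 0)
      (𝓝 (-(secondMoment p : ℂ) / 2)) := by
  have h1 : (-(secondMoment p : ℂ) / 2) = ∫ x : ℤ, (-(((x : ℝ) : ℂ)) ^ 2 / 2) ∂p.toMeasure := by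
    rw [← integral_sq hκ, ← integral_complex_ofReal, ← integral_neg, ← integral_div]
    push_cast
    rfl
  rw [h1]
  simp_rw [charRem_eq_integral hκ, ← integral_div]
  refine tendsto_integral_filter_of_dominated_convergence (fun x : ℤ => 3 * (x : ℝ) ^ 2)
    (Eventually.of_forall fun w => (measurable_of_int _).aestronglyMeasurable) ?_
    ((integrable_sq hκ).const_mul 3) (ae_of_all _ fun x => tendsto_expRem_div x)
  filter_upwards [self_mem_nhdsWithin] with w hw
  have hw : w ≠ 0 := hw
  refine ae_of_all _ fun x => ?_
  rw [norm_div, norm_pow, Complex.norm_real, Real.norm_eq_abs, sq_abs,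
    div_le_iff₀ (by positivity)]
  exact (norm_expRem_le _).trans_eq (by ring)

/-! ### Central limit theorem and tail bound -/

/-- Law of the centred and diffusively rescaled displacement. -/
noncomputable def scaledLaw (p : PMF ℤ) (t : ℝ≥0) (n : ℕ) : Measure ℝ :=
  (displacementLaw p (n * t)).map fun z : ℤ => ((z : ℝ) - n * drift p * t) / √(n : ℝ)

instance isProbabilityMeasure_scaledLaw (p : PMF ℤ) (t : ℝ≥0) (n : ℕ) :
    IsProbabilityMeasure (scaledLaw p t n) :=
  Measure.isProbabilityMeasure_map (measurable_of_int _).aemeasurable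

/-- The displacement is compound Poisson, so centring by `n v t` exactly removes the linear term of
the exponent and leaves only `charRem`. -/
lemma charFun_scaledLaw (p : PMF ℤ) (t : ℝ≥0) (n : ℕ) (u : ℝ) :
    charFun (scaledLaw p t n) u = Complex.exp (n * t * charRem p (u / √(n : ℝ))) := by
  rw [charFun_apply_real, scaledLaw, integral_map (measurable_of_int _).aemeasurable
    (Continuous.aestronglyMeasurable (by fun_prop))]
  have h : ∀ z : ℤ, Complex.exp ((u : ℂ) * ((((z : ℝ) - n * drift p * t) / √(n : ℝ) : ℝ) : ℂ)
        * Complex.I)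
      = Complex.exp (-(n * t * ((u / √(n : ℝ) : ℝ) : ℂ) * drift p * Complex.I))
        * Complex.exp (((u / √(n : ℝ) : ℝ) : ℂ) * z * Complex.I) := by
    intro z
    rw [← Complex.exp_add]
    congr 1
    push_cast
    ring
  simp_rw [h]
  rw [integral_const_mul, integral_cexp_displacementLaw, ← Complex.exp_add, charRem]
  congr 1
  push_cast
  ring

lemma tendsto_charFun_scaledLaw {p : PMF ℤ} (hκ : 0 < secondMoment p) (t : ℝ≥0) (u : ℝ) :
    Tendsto (fun n => charFun (scaledLaw p t n) u) atTop
      (𝓝 (charFun (gaussianReal 0 (secondMoment p * t).toNNReal) u)) := by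
  rw [charFun_gaussianReal, Real.coe_toNNReal _ (by positivity)]
  simp_rw [charFun_scaledLaw]
  refine (Complex.continuous_exp.tendsto _).comp ?_
  rcases eq_or_ne u 0 with rfl | hu
  · have : charRem p 0 = 0 := by
      have := norm_charRem_le hκ 0
      simpa using this
    simp [this]
  have hw : Tendsto (fun n : ℕ => u / √(n : ℝ)) atTop (𝓝[≠] 0) := by
    refine tendsto_nhdsWithin_iff.2 ⟨tendsto_const_nhds.div_atTop tendsto_sqrt_natCast_atTop, ?_⟩
    filter_upwards [eventually_gt_atTop 0] with n hn
    exact div_ne_zero hu (Real.sqrt_pos.2 (by exact_mod_cast hn)).ne'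
  have h1 := ((tendsto_charRem_div hκ).comp hw).const_mul ((t : ℂ) * u ^ 2)
  have h2 : (t : ℂ) * u ^ 2 * (-(secondMoment p : ℂ) / 2)
      = u * (0 : ℝ) * Complex.I - ((secondMoment p * t : ℝ) : ℂ) * u ^ 2 / 2 := by
    push_cast; ring
  rw [h2] at h1
  refine h1.congr' ?_
  filter_upwards [eventually_gt_atTop 0] with n hn
  have hn' : (0 : ℝ) < n := by exact_mod_cast hn
  have hs : ((√(n : ℝ) : ℝ) : ℂ) ^ 2 = n := by
    rw [← Complex.ofReal_pow, Real.sq_sqrt hn'.le]; simp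
  have hs0 : ((√(n : ℝ) : ℝ) : ℂ) ≠ 0 := by exact_mod_cast (Real.sqrt_pos.2 hn').ne'
  have hu' : (u : ℂ) ≠ 0 := by exact_mod_cast hu
  simp only [Function.comp]
  push_cast
  rw [div_pow, hs]
  field_simp

lemma tendsto_scaledLaw_Iic {p : PMF ℤ} (hκ : 0 < secondMoment p) {t : ℝ≥0} (ht : 0 < t)
    (y : ℝ) : Tendsto (fun n => (scaledLaw p t n).real (Iic y)) atTop
      (𝓝 (Phi (secondMoment p * t) y)) := by
  have hv : (secondMoment p * t).toNNReal ≠ 0 := by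
    have : 0 < secondMoment p * t := mul_pos hκ ht
    simpa using this
  have hna := nullSingletonClass_gaussianReal (μ := 0) hv
  have := ProbabilityMeasure.tendsto_of_tendsto_charFun (E := ℝ)
    (μ := fun n => ⟨scaledLaw p t n, inferInstance⟩)
    (μ₀ := ⟨gaussianReal 0 (secondMoment p * t).toNNReal, inferInstance⟩)
    (tendsto_charFun_scaledLaw hκ t)
  have h2 := ProbabilityMeasure.tendsto_measure_of_null_frontier_of_tendsto' this (E := Iic y)
    (by rw [frontier_Iic]; exact hna.measure_singleton y)
  rw [Phi, cdf_eq_real]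
  exact (ENNReal.tendsto_toReal (measure_ne_top _ _)).comp h2

/-- A Chebyshev-type bound read off from the characteristic function near zero. There `|1 - φ(u)| ≤
6 κ₂ t u²`: use `|e^z - 1| ≤ 2 |z|` if `|z| ≤ 1` and the trivial bound 2 otherwise. Integrating over
`|u| ≤ 2 / r` with the prefactor `r / 2` produces the 48. -/
lemma tail_scaledLaw_le {p : PMF ℤ} (hκ : 0 < secondMoment p) (t : ℝ≥0) {n : ℕ} (hn : 0 < n)
    {r : ℝ} (hr : 0 < r) :
    (scaledLaw p t n).real {x | r < |x|} ≤ 48 * (secondMoment p * t) / r ^ 2 := by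
  have hn' : (0 : ℝ) < n := by exact_mod_cast hn
  have hb : ∀ u : ℝ, ‖1 - charFun (scaledLaw p t n) u‖ ≤ 6 * (secondMoment p * t) * u ^ 2 := by
    intro u
    have hz : ‖(n * t * charRem p (u / √(n : ℝ)) : ℂ)‖ ≤ 3 * (secondMoment p * t) * u ^ 2 := by
      rw [norm_mul, norm_mul]
      have h1 := norm_charRem_le hκ (u / √(n : ℝ))
      rw [div_pow, Real.sq_sqrt hn'.le] at h1
      have h2 : ‖(n : ℂ)‖ = n := by simp
      have h3 : ‖((t : ℝ) : ℂ)‖ = t := by simp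
      rw [h2, h3]
      calc (n : ℝ) * t * ‖charRem p (u / √(n : ℝ))‖
          ≤ n * t * (3 * secondMoment p * (u ^ 2 / n)) := by gcongr
        _ = _ := by field_simp
    rcases le_total ‖(n * t * charRem p (u / √(n : ℝ)) : ℂ)‖ 1 with h | h
    · rw [charFun_scaledLaw, norm_sub_rev]
      refine (Complex.norm_exp_sub_one_le h).trans ?_
      linarith
    · refine norm_one_sub_charFun_le_two.trans ?_
      linarith
  refine (measureReal_abs_gt_le_integral_charFun hr).trans ?_
  have h1 : ‖∫ u in (-2 * r⁻¹)..(2 * r⁻¹), 1 - charFun (scaledLaw p t n) u‖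
      ≤ 6 * (secondMoment p * t) * (2 * r⁻¹) ^ 2 * |2 * r⁻¹ - -2 * r⁻¹| := by
    refine intervalIntegral.norm_integral_le_of_norm_le_const fun u hu => (hb u).trans ?_
    rw [uIoc_of_le (by have : 0 < r⁻¹ := by positivity
                       linarith)] at hu
    have : u ^ 2 ≤ (2 * r⁻¹) ^ 2 := sq_le_sq' (by linarith [hu.1]) hu.2
    gcongr
  rw [show 2 * r⁻¹ - -2 * r⁻¹ = 4 * r⁻¹ by ring, abs_of_pos (by positivity)] at h1
  calc 2⁻¹ * r * ‖∫ u in (-2 * r⁻¹)..(2 * r⁻¹), 1 - charFun (scaledLaw p t n) u‖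
      ≤ 2⁻¹ * r * (6 * (secondMoment p * t) * (2 * r⁻¹) ^ 2 * (4 * r⁻¹)) := by gcongr
    _ = _ := by field_simp; ring

/-! ### Exponential moments of functionals of a particle system at a fixed time -/

/-- Occupation variables `η` with i.i.d. law `ν` and an independent i.i.d. family of
displacements `X` of law `D`. -/
structure IsMarkedSystem {Ω : Type*} [MeasurableSpace Ω] (P : Measure Ω) (ν : Measure ℕ)
    (D : Measure ℤ) (η : ℤ → Ω → ℕ) (X : ℤ × ℕ → Ω → ℤ) : Prop where
  measurable_occ : ∀ m, Measurable (η m)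
  measurable_pos : ∀ a, Measurable (X a)
  law_occ : ∀ m, P.map (η m) = ν
  law_pos : ∀ a, P.map (X a) = D
  indep_occ : iIndepFun η P
  indep_pos : iIndepFun X P
  indep : IndepFun (fun ω m => η m ω) (fun ω a => X a ω) P

/-- `g` is the logarithm of the generating function of `ν`, with the regularity used below. -/
structure IsLogPGF (ν : Measure ℕ) (g : ℝ → ℝ) : Prop where
  lintegral_pow : ∀ u, 0 < u → ∫⁻ k, ENNReal.ofReal u ^ k ∂ν = ENNReal.ofReal (Real.exp (g u))
  continuousOn : ContinuousOn g (Ioi 0)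
  bound : ∀ ε, 0 < ε → ∃ M, 0 ≤ M ∧ ∀ u, ε ≤ u → |g u| ≤ M * |u - 1|

lemma measurable_prod_range {α M : Type*} [MeasurableSpace α] [CommMonoid M] [MeasurableSpace M]
    [MeasurableMul₂ M] {N : α → ℕ} (hN : Measurable N) {f : ℕ → α → M}
    (hf : ∀ j, Measurable (f j)) : Measurable fun a => ∏ j ∈ Finset.range (N a), f j a := by
  have h : Measurable fun z : ℕ × α => ∏ j ∈ Finset.range z.1, f j z.2 :=
    measurable_from_prod_countable_right fun k =>
      Finset.measurable_fun_prod (Finset.range k) fun j _ => hf j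
  exact h.comp (hN.prodMk measurable_id)

lemma measurable_sum_range {α : Type*} [MeasurableSpace α] {N : α → ℕ} (hN : Measurable N)
    {f : ℕ → α → ℝ} (hf : ∀ j, Measurable (f j)) :
    Measurable fun a => ∑ j ∈ Finset.range (N a), f j a := by
  have h : Measurable fun z : ℕ × α => ∑ j ∈ Finset.range z.1, f j z.2 :=
    measurable_from_prod_countable_right fun k =>
      Finset.measurable_fun_sum (Finset.range k) fun j _ => hf j
  exact h.comp (hN.prodMk measurable_id)

/-- Number of particles started from `m` whose displacement lies in `A m`. -/
noncomputable def hits {Ω : Type*} (η : ℤ → Ω → ℕ) (X : ℤ × ℕ → Ω → ℤ) (A : ℤ → Set ℤ) (m : ℤ)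
    (ω : Ω) : ℝ :=
  ∑ j ∈ Finset.range (η m ω), (A m).indicator 1 (X (m, j) ω)

lemma hits_nonneg {Ω : Type*} {η : ℤ → Ω → ℕ} {X : ℤ × ℕ → Ω → ℤ} (A : ℤ → Set ℤ) (m : ℤ)
    (ω : Ω) : 0 ≤ hits η X A m ω :=
  Finset.sum_nonneg fun _ _ => indicator_nonneg (fun _ _ => zero_le_one) _

lemma IsMarkedSystem.measurable_hits {Ω : Type*} [MeasurableSpace Ω] {P : Measure Ω} {ν : Measure ℕ}
    {D : Measure ℤ} {η : ℤ → Ω → ℕ} {X : ℤ × ℕ → Ω → ℤ} (h : IsMarkedSystem P ν D η X)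
    (A : ℤ → Set ℤ) (m : ℤ) :
    Measurable (hits η X A m) :=
  measurable_sum_range (h.measurable_occ m) fun j =>
    (measurable_of_int ((A m).indicator 1)).comp (h.measurable_pos (m, j))

section System

variable {Ω : Type*} [MeasurableSpace Ω] {P : Measure Ω} {ν : Measure ℕ}
  {D : Measure ℤ} {η : ℤ → Ω → ℕ} {X : ℤ × ℕ → Ω → ℤ}

lemma IsWalkSystem.isMarkedSystem {p : PMF ℤ} {ξ : ℤ × ℕ → ℝ≥0 → Ω → ℤ}
    (h : IsWalkSystem p ν P η ξ) (T : ℝ≥0) :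
    IsMarkedSystem P ν (displacementLaw p T) η (fun a => ξ a T) where
  measurable_occ := h.measurable_occ
  measurable_pos a := (h.walk a).measurable T
  law_occ := h.law_occ
  law_pos a := by
    rw [← (h.walk a).law_increments 0 T]
    refine Measure.map_congr ?_
    filter_upwards [(h.walk a).start] with ω hω
    rw [hω, zero_add, sub_zero]
  indep_occ := h.indep_occ
  indep_pos := h.indep_walks.comp (fun _ x => x T) fun _ => measurable_pi_apply T
  indep := by
    have hψ : Measurable fun (x : ℤ × ℕ → ℝ≥0 → ℤ) a => x a T :=
      measurable_pi_lambda _ fun a => (measurable_pi_apply T).comp (measurable_pi_apply a)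
    exact h.indep_occ_walks.comp measurable_id hψ

variable [IsProbabilityMeasure P]

/-- Fubini over occupations and displacements: for frozen occupations `k` the displacements give
powers `(∫⁻ f m)^(k m)`, and the independence of the occupations then factorizes over sites. Working
with `lintegral` avoids integrability conditions. -/
lemma IsMarkedSystem.lintegral_prod_prod (h : IsMarkedSystem P ν D η X) (f : ℤ → ℤ → ℝ≥0∞)
    (S : Finset ℤ) :
    ∫⁻ ω, ∏ m ∈ S, ∏ j ∈ Finset.range (η m ω), f m (X (m, j) ω) ∂P
      = ∏ m ∈ S, ∫⁻ k, (∫⁻ z, f m z ∂D) ^ k ∂ν := by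
  have hη : Measurable fun ω m => η m ω := measurable_pi_lambda _ h.measurable_occ
  have hX : Measurable fun ω a => X a ω := measurable_pi_lambda _ h.measurable_pos
  have hF : Measurable fun z : (ℤ → ℕ) × (ℤ × ℕ → ℤ) =>
      ∏ m ∈ S, ∏ j ∈ Finset.range (z.1 m), f m (z.2 (m, j)) :=
    Finset.measurable_fun_prod _ fun m _ => measurable_prod_range
      ((measurable_pi_apply m).comp measurable_fst) fun j =>
        (measurable_of_int (f m)).comp ((measurable_pi_apply _).comp measurable_snd)
  have hjoint := (indepFun_iff_map_prod_eq_prod_map_map hη.aemeasurable hX.aemeasurable).1 h.indep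
  have hinner : ∀ k : ℤ → ℕ, ∫⁻ ω, ∏ m ∈ S, ∏ j ∈ Finset.range (k m), f m (X (m, j) ω) ∂P
      = ∏ m ∈ S, (∫⁻ z, f m z ∂D) ^ (k m) := by
    intro k
    have hind : iIndepFun (fun (i : Σ _ : ℤ, ℕ) ω => f i.1 (X (i.1, i.2) ω)) P :=
      (h.indep_pos.precomp (Equiv.sigmaEquivProd ℤ ℕ).injective).comp
        (fun i => f i.1) fun i => measurable_of_int _
    have hmeas : ∀ i : Σ _ : ℤ, ℕ, Measurable fun ω => f i.1 (X (i.1, i.2) ω) := fun i =>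
      (measurable_of_int (f i.1)).comp (h.measurable_pos _)
    have := lintegral_prod_eq_prod_lintegral_of_indepFun
      (S.sigma fun m => Finset.range (k m)) _ hind hmeas
    simp_rw [Finset.prod_sigma] at this
    rw [this]
    refine Finset.prod_congr rfl fun m _ => ?_
    have hl : ∀ j, ∫⁻ ω, f m (X (m, j) ω) ∂P = ∫⁻ z, f m z ∂D := fun j => by
      rw [← h.law_pos (m, j), lintegral_map (measurable_of_int _) (h.measurable_pos _)]
    simp [hl]
  calc ∫⁻ ω, ∏ m ∈ S, ∏ j ∈ Finset.range (η m ω), f m (X (m, j) ω) ∂P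
      = ∫⁻ z, ∏ m ∈ S, ∏ j ∈ Finset.range (z.1 m), f m (z.2 (m, j))
          ∂(P.map fun ω => ((fun m => η m ω), fun a => X a ω)) := by
        rw [lintegral_map hF (hη.prodMk hX)]
    _ = ∫⁻ k, ∏ m ∈ S, (∫⁻ z, f m z ∂D) ^ (k m) ∂(P.map fun ω m => η m ω) := by
        have := Measure.isProbabilityMeasure_map (μ := P) hX.aemeasurable
        rw [hjoint, lintegral_prod _ hF.aemeasurable]
        congr 1 with k
        rw [← hinner k]
        exact lintegral_map (hF.comp measurable_prodMk_left) hX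
    _ = ∫⁻ ω, ∏ m ∈ S, (∫⁻ z, f m z ∂D) ^ (η m ω) ∂P := by
        rw [lintegral_map _ hη]
        exact Finset.measurable_fun_prod _ fun m _ =>
          (measurable_from_top (f := fun k : ℕ => (∫⁻ z, f m z ∂D) ^ k)).comp
            (measurable_pi_apply m)
    _ = _ := by
        rw [lintegral_prod_eq_prod_lintegral_of_indepFun S
          (fun m ω => (∫⁻ z, f m z ∂D) ^ (η m ω))
          (h.indep_occ.comp (fun m k => (∫⁻ z, f m z ∂D) ^ k) fun m => measurable_from_top)
          fun m => measurable_from_top.comp (h.measurable_occ m)]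
        refine Finset.prod_congr rfl fun m _ => ?_
        rw [← h.law_occ m, lintegral_map measurable_from_top (h.measurable_occ m)]

lemma lintegral_exp_indicator [IsProbabilityMeasure D] (A : Set ℤ) (c : ℝ) :
    ∫⁻ z, ENNReal.ofReal (Real.exp (c * A.indicator 1 z)) ∂D
      = ENNReal.ofReal (1 + (Real.exp c - 1) * D.real A) := by
  have hA : MeasurableSet A := MeasurableSet.of_discrete
  have heq : ∀ z, Real.exp (c * A.indicator 1 z)
      = 1 + (Real.exp c - 1) * A.indicator (fun _ => (1 : ℝ)) z := fun z => by
    by_cases hz : z ∈ A <;> simp [hz]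
  have hi : Integrable (A.indicator fun _ => (1 : ℝ)) D := (integrable_const _).indicator hA
  have hi2 := hi.const_mul (Real.exp c - 1)
  rw [← ofReal_integral_eq_lintegral_ofReal]
  · simp_rw [heq]
    rw [integral_add (integrable_const _) hi2, integral_const_mul, integral_indicator hA]
    simp
  · simp_rw [heq]
    exact (integrable_const _).add hi2
  · exact ae_of_all _ fun _ => (Real.exp_pos _).le

/-- The right side is a convex combination of `1` and `e^c`. It keeps the argument of `g` away from
`0`, where `g` may be singular. -/
lemma one_add_mul_ge {c q : ℝ} (h0 : 0 ≤ q) (h1 : q ≤ 1) :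
    Real.exp (-|c|) ≤ 1 + (Real.exp c - 1) * q := by
  have k1 : Real.exp (-|c|) ≤ Real.exp c := Real.exp_le_exp.2 (neg_abs_le c)
  have k2 : Real.exp (-|c|) ≤ 1 := Real.exp_le_one_iff.2 (by simp)
  nlinarith

lemma IsMarkedSystem.lintegral_exp_sum_hits [IsProbabilityMeasure D]
    (h : IsMarkedSystem P ν D η X) {g : ℝ → ℝ}
    (hg : IsLogPGF ν g) (A : ℤ → Set ℤ) (c : ℤ → ℝ) (S : Finset ℤ) :
    ∫⁻ ω, ENNReal.ofReal (Real.exp (∑ m ∈ S, c m * hits η X A m ω)) ∂P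
      = ENNReal.ofReal (Real.exp (∑ m ∈ S, g (1 + (Real.exp (c m) - 1) * D.real (A m)))) := by
  have heq : ∀ ω, ENNReal.ofReal (Real.exp (∑ m ∈ S, c m * hits η X A m ω))
      = ∏ m ∈ S, ∏ j ∈ Finset.range (η m ω),
        ENNReal.ofReal (Real.exp (c m * (A m).indicator 1 (X (m, j) ω))) := by
    intro ω
    rw [Real.exp_sum, ENNReal.ofReal_prod_of_nonneg fun _ _ => (Real.exp_pos _).le]
    refine Finset.prod_congr rfl fun m _ => ?_
    rw [hits, Finset.mul_sum, Real.exp_sum,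
      ENNReal.ofReal_prod_of_nonneg fun _ _ => (Real.exp_pos _).le]
  simp_rw [heq]
  rw [h.lintegral_prod_prod fun m z => ENNReal.ofReal (Real.exp (c m * (A m).indicator 1 z)),
    Real.exp_sum, ENNReal.ofReal_prod_of_nonneg fun _ _ => (Real.exp_pos _).le]
  refine Finset.prod_congr rfl fun m _ => ?_
  rw [lintegral_exp_indicator]
  exact hg.lintegral_pow _ ((Real.exp_pos _).trans_le
    (one_add_mul_ge (c := c m) measureReal_nonneg measureReal_le_one))

lemma tendsto_Icc_neg_natCast : Tendsto (fun N : ℕ => Finset.Icc (-(N : ℤ)) N) atTop atTop := by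
  refine tendsto_atTop_finset_of_monotone (fun a b hab => ?_) fun x => ⟨x.natAbs, ?_⟩
  · exact Finset.Icc_subset_Icc (by omega) (by omega)
  · rw [Finset.mem_Icc]; omega

/-- Far sites have small `q m`, so the argument of `g` is near `1`, where `bound` makes `g` vanish
linearly. -/
lemma IsLogPGF.summable {g : ℝ → ℝ} (hg : IsLogPGF ν g) {q : ℤ → ℝ} (hq : Summable q)
    (h0 : ∀ m, 0 ≤ q m) (h1 : ∀ m, q m ≤ 1) {c : ℤ → ℝ} {C : ℝ} (hc : ∀ m, |c m| ≤ C) :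
    Summable fun m => g (1 + (Real.exp (c m) - 1) * q m) := by
  obtain ⟨M, hM0, hM⟩ := hg.bound (Real.exp (-C)) (Real.exp_pos _)
  refine Summable.of_norm_bounded (hq.mul_left (M * (Real.exp C + 1))) fun m => ?_
  have hlow : Real.exp (-C) ≤ 1 + (Real.exp (c m) - 1) * q m :=
    (Real.exp_le_exp.2 (neg_le_neg (hc m))).trans (one_add_mul_ge (h0 m) (h1 m))
  refine (hM _ hlow).trans ?_
  rw [add_sub_cancel_left, abs_mul, abs_of_nonneg (h0 m), mul_assoc]
  have h2 : Real.exp (c m) ≤ Real.exp C := Real.exp_le_exp.2 ((le_abs_self _).trans (hc m))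
  have h3 : |Real.exp (c m) - 1| ≤ Real.exp C + 1 := by
    rw [abs_le]; constructor <;> linarith [Real.exp_pos (c m), Real.exp_pos C]
  have := h0 m
  gcongr

/-- The exponential moments of the counts over `[-N, N]` are exponentials of partial sums of a
convergent series, hence bounded, and monotone convergence passes to the total. Almost sure
summability matters in itself: it ensures that the `tsum` in the current is a genuine sum and not
the default value `0`. -/
lemma IsMarkedSystem.integrable_exp_tsum_hits [IsProbabilityMeasure D]
    (h : IsMarkedSystem P ν D η X) {g : ℝ → ℝ} (hg : IsLogPGF ν g) {A : ℤ → Set ℤ}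
    (hA : Summable fun m => D.real (A m)) {c : ℝ} (hc : 0 < c) :
    (∀ᵐ ω ∂P, Summable fun m => hits η X A m ω) ∧
      Integrable (fun ω => Real.exp (c * ∑' m, hits η X A m ω)) P := by
  have hsum := hg.summable hA (fun m => measureReal_nonneg) (fun m => measureReal_le_one)
    (c := fun _ => c) (C := |c|) fun _ => le_rfl
  have hlim := (Real.continuous_exp.tendsto _).comp (hsum.hasSum.comp tendsto_Icc_neg_natCast)
  obtain ⟨B, hB⟩ := hlim.bddAbove_range
  have hBle : ∀ N : ℕ, ∫⁻ ω, ENNReal.ofReal (Real.exp (∑ m ∈ Finset.Icc (-(N : ℤ)) N,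
      c * hits η X A m ω)) ∂P ≤ ENNReal.ofReal B := fun N => by
    rw [h.lintegral_exp_sum_hits hg A (fun _ => c)]
    exact ENNReal.ofReal_le_ofReal (hB ⟨N, rfl⟩)
  have hmeas : ∀ N : ℕ, Measurable fun ω => ENNReal.ofReal (Real.exp
      (∑ m ∈ Finset.Icc (-(N : ℤ)) N, c * hits η X A m ω)) := fun N =>
    (Real.measurable_exp.comp (Finset.measurable_fun_sum _ fun m _ =>
      (h.measurable_hits A m).const_mul c)).ennreal_ofReal
  have hmono : Monotone fun (N : ℕ) ω => ENNReal.ofReal (Real.exp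
      (∑ m ∈ Finset.Icc (-(N : ℤ)) N, c * hits η X A m ω)) := fun N M hNM ω => by
    refine ENNReal.ofReal_le_ofReal (Real.exp_le_exp.2 (Finset.sum_le_sum_of_subset_of_nonneg
      (Finset.Icc_subset_Icc (by omega) (by omega)) fun m _ _ => ?_))
    exact mul_nonneg hc.le (hits_nonneg A m ω)
  have hsup : ∫⁻ ω, ⨆ N : ℕ, ENNReal.ofReal (Real.exp
      (∑ m ∈ Finset.Icc (-(N : ℤ)) N, c * hits η X A m ω)) ∂P ≤ ENNReal.ofReal B := by
    rw [lintegral_iSup hmeas hmono]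
    exact iSup_le hBle
  have hsummable : ∀ᵐ ω ∂P, Summable fun m => hits η X A m ω := by
    filter_upwards [ae_lt_top (Measurable.iSup hmeas) (hsup.trans_lt ENNReal.ofReal_lt_top).ne]
      with ω hω
    set R := ⨆ N : ℕ, ENNReal.ofReal (Real.exp
      (∑ m ∈ Finset.Icc (-(N : ℤ)) N, c * hits η X A m ω)) with hR
    refine summable_of_sum_le (c := R.toReal / c) (fun m => hits_nonneg A m ω) fun u => ?_
    obtain ⟨N, hN⟩ := (tendsto_Icc_neg_natCast.eventually_ge_atTop u).exists
    have h1 : ENNReal.ofReal (Real.exp (∑ m ∈ Finset.Icc (-(N : ℤ)) N, c * hits η X A m ω)) ≤ R :=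
      le_iSup (fun N : ℕ => ENNReal.ofReal (Real.exp
        (∑ m ∈ Finset.Icc (-(N : ℤ)) N, c * hits η X A m ω))) N
    have h2 := (ENNReal.ofReal_le_iff_le_toReal hω.ne).1 h1
    have h3 := Real.add_one_le_exp (∑ m ∈ Finset.Icc (-(N : ℤ)) N, c * hits η X A m ω)
    have h4 : ∑ m ∈ u, hits η X A m ω ≤ ∑ m ∈ Finset.Icc (-(N : ℤ)) N, hits η X A m ω :=
      Finset.sum_le_sum_of_subset_of_nonneg hN fun m _ _ => hits_nonneg A m ω
    rw [le_div_iff₀ hc]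
    rw [← Finset.mul_sum] at h2 h3
    nlinarith
  refine ⟨hsummable, ?_⟩
  have htend : ∀ᵐ ω ∂P, Tendsto (fun N : ℕ => Real.exp
      (∑ m ∈ Finset.Icc (-(N : ℤ)) N, c * hits η X A m ω)) atTop
      (𝓝 (Real.exp (c * ∑' m, hits η X A m ω))) := by
    filter_upwards [hsummable] with ω hω
    exact (Real.continuous_exp.tendsto _).comp
      ((hω.hasSum.mul_left c).comp tendsto_Icc_neg_natCast)
  refine ⟨aestronglyMeasurable_of_tendsto_ae atTop (fun N : ℕ => ?_) htend, ?_⟩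
  · exact (Real.measurable_exp.comp (Finset.measurable_fun_sum _ fun m _ =>
      (h.measurable_hits A m).const_mul c)).aestronglyMeasurable
  · rw [hasFiniteIntegral_iff_ofReal (ae_of_all _ fun ω => (Real.exp_pos _).le)]
    refine lt_of_le_of_lt (le_trans (lintegral_mono_ae ?_) hsup) ENNReal.ofReal_lt_top
    filter_upwards [htend] with ω hω
    exact le_of_tendsto (ENNReal.tendsto_ofReal hω) (Eventually.of_forall fun N =>
      le_iSup (fun N : ℕ => ENNReal.ofReal (Real.exp
        (∑ m ∈ Finset.Icc (-(N : ℤ)) N, c * hits η X A m ω))) N)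

theorem IsMarkedSystem.cgf_tsum_signed_hits [IsProbabilityMeasure D]
    (h : IsMarkedSystem P ν D η X) {g : ℝ → ℝ} (hg : IsLogPGF ν g) {A : ℤ → Set ℤ}
    (hA : Summable fun m => D.real (A m)) {s : ℤ → ℝ} (hs : ∀ m, |s m| = 1) :
    AEMeasurable (fun ω => ∑' m, s m * hits η X A m ω) P ∧
    (∀ l, Integrable (fun ω => Real.exp (l * ∑' m, s m * hits η X A m ω)) P) ∧
    ∀ l, cgf (fun ω => ∑' m, s m * hits η X A m ω) P l
      = ∑' m, g (1 + (Real.exp (l * s m) - 1) * D.real (A m)) := by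
  have hsummable := (h.integrable_exp_tsum_hits hg hA one_pos).1
  have hpart : ∀ N : ℕ, Measurable fun ω => ∑ m ∈ Finset.Icc (-(N : ℤ)) N, s m * hits η X A m ω :=
    fun N => Finset.measurable_fun_sum _ fun m _ => (h.measurable_hits A m).const_mul _
  have habs : ∀ m ω, |s m * hits η X A m ω| = hits η X A m ω := fun m ω => by
    rw [abs_mul, hs, one_mul, abs_of_nonneg (hits_nonneg A m ω)]
  have htend : ∀ᵐ ω ∂P, Tendsto
      (fun N : ℕ => ∑ m ∈ Finset.Icc (-(N : ℤ)) N, s m * hits η X A m ω) atTop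
      (𝓝 (∑' m, s m * hits η X A m ω)) := by
    filter_upwards [hsummable] with ω hω
    have : Summable fun m => s m * hits η X A m ω := by
      refine Summable.of_abs ?_
      simp_rw [habs]; exact hω
    exact this.hasSum.comp tendsto_Icc_neg_natCast
  have hle : ∀ᵐ ω ∂P, ∀ u : Finset ℤ, ∀ l : ℝ,
      Real.exp (l * ∑ m ∈ u, s m * hits η X A m ω)
        ≤ Real.exp ((|l| + 1) * ∑' m, hits η X A m ω) := by
    filter_upwards [hsummable] with ω hω u l
    refine Real.exp_le_exp.2 ((le_abs_self _).trans ?_)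
    rw [abs_mul]
    have h1 : |∑ m ∈ u, s m * hits η X A m ω| ≤ ∑' m, hits η X A m ω := by
      refine (Finset.abs_sum_le_sum_abs _ _).trans ?_
      simp_rw [habs]
      exact hω.sum_le_tsum u fun m _ => hits_nonneg A m ω
    have h2 : 0 ≤ ∑' m, hits η X A m ω := tsum_nonneg fun m => hits_nonneg A m ω
    nlinarith [abs_nonneg l]
  have hae : AEMeasurable (fun ω => ∑' m, s m * hits η X A m ω) P :=
    aemeasurable_of_tendsto_metrizable_ae atTop (fun N => (hpart N).aemeasurable) htend
  -- The exponent `|l| + 1` instead of `|l|` keeps the constant positive when `l = 0`.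
  have hdom : ∀ l : ℝ, Integrable (fun ω => Real.exp ((|l| + 1) * ∑' m, hits η X A m ω)) P :=
    fun l => (h.integrable_exp_tsum_hits hg hA (by positivity)).2
  have htend2 : ∀ l : ℝ, ∀ᵐ ω ∂P, Tendsto (fun N : ℕ => Real.exp (l *
      ∑ m ∈ Finset.Icc (-(N : ℤ)) N, s m * hits η X A m ω)) atTop
      (𝓝 (Real.exp (l * ∑' m, s m * hits η X A m ω))) := fun l => by
    filter_upwards [htend] with ω hω
    exact (Real.continuous_exp.tendsto _).comp (hω.const_mul l)
  have hint : ∀ l, Integrable (fun ω => Real.exp (l * ∑' m, s m * hits η X A m ω)) P := by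
    intro l
    refine (hdom l).mono' (Real.measurable_exp.comp_aemeasurable
      (hae.const_mul l)).aestronglyMeasurable ?_
    filter_upwards [htend2 l, hle] with ω hω hle
    rw [Real.norm_eq_abs, abs_of_pos (Real.exp_pos _)]
    exact le_of_tendsto hω (Eventually.of_forall fun N => hle _ l)
  refine ⟨hae, hint, fun l => ?_⟩
  have hsum := hg.summable hA (fun m => measureReal_nonneg) (fun m => measureReal_le_one)
    (c := fun m => l * s m) (C := |l|) fun m => by rw [abs_mul, hs, mul_one]
  have hlim1 := (Real.continuous_exp.tendsto _).comp (hsum.hasSum.comp tendsto_Icc_neg_natCast)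
  have hlim2 : Tendsto (fun N : ℕ => ∫ ω, Real.exp (l *
      ∑ m ∈ Finset.Icc (-(N : ℤ)) N, s m * hits η X A m ω) ∂P) atTop
      (𝓝 (mgf (fun ω => ∑' m, s m * hits η X A m ω) P l)) := by
    refine tendsto_integral_of_dominated_convergence _ (fun N =>
      (Real.measurable_exp.comp ((hpart N).const_mul l)).aestronglyMeasurable) (hdom l)
      (fun N => ?_) (htend2 l)
    filter_upwards [hle] with ω hle
    rw [Real.norm_eq_abs, abs_of_pos (Real.exp_pos _)]
    exact hle _ l
  have heq : ∀ N : ℕ, ∫ ω, Real.exp (l *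
      ∑ m ∈ Finset.Icc (-(N : ℤ)) N, s m * hits η X A m ω) ∂P
      = Real.exp (∑ m ∈ Finset.Icc (-(N : ℤ)) N,
        g (1 + (Real.exp (l * s m) - 1) * D.real (A m))) := by
    intro N
    rw [integral_eq_lintegral_of_nonneg_ae (ae_of_all _ fun _ => (Real.exp_pos _).le)
      (Real.measurable_exp.comp ((hpart N).const_mul l)).aestronglyMeasurable]
    simp_rw [Finset.mul_sum, ← mul_assoc]
    rw [h.lintegral_exp_sum_hits hg A (fun m => l * s m),
      ENNReal.toReal_ofReal (Real.exp_pos _).le]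
  simp_rw [heq] at hlim2
  rw [cgf, tendsto_nhds_unique hlim2 hlim1, Real.log_exp]

end System

/-! ### The Gaussian distribution function -/

section Phi

variable {v : ℝ}

lemma Phi_eq_real (v y : ℝ) : Phi v y = (gaussianReal 0 v.toNNReal).real (Iic y) := by
  rw [Phi, cdf_eq_real]

lemma one_sub_Phi_eq_real (v y : ℝ) : 1 - Phi v y = (gaussianReal 0 v.toNNReal).real (Ioi y) := by
  rw [Phi_eq_real, ← compl_Iic, probReal_compl_eq_one_sub measurableSet_Iic]

lemma monotone_Phi (v : ℝ) : Monotone (Phi v) := monotone_cdf _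

lemma continuous_Phi (hv : 0 < v) : Continuous (Phi v) := by
  have hna := nullSingletonClass_gaussianReal (μ := 0) (v := v.toNNReal) (by simpa using hv)
  refine continuous_iff_continuousAt.2 fun y => ?_
  have hmono := monotone_cdf (gaussianReal 0 v.toNNReal)
  have h1 := (cdf (gaussianReal 0 v.toNNReal)).measure_singleton y
  rw [measure_cdf, hna.measure_singleton, eq_comm, ENNReal.ofReal_eq_zero] at h1
  have h2 := hmono.leftLim_le (le_refl y)
  change ContinuousAt (cdf (gaussianReal 0 v.toNNReal)) y
  rw [hmono.continuousAt_iff_leftLim_eq_rightLim, StieltjesFunction.rightLim_eq]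
  linarith

lemma Phi_pos (hv : 0 < v) (y : ℝ) : 0 < Phi v y := by
  rw [Phi_eq_real]
  refine ENNReal.toReal_pos (fun h => ?_) (measure_ne_top _ _)
  have := gaussianReal_absolutelyContinuous' 0 (v := v.toNNReal) (by simpa using hv) h
  simp at this

lemma Phi_lt_one (hv : 0 < v) (y : ℝ) : Phi v y < 1 := by
  rw [← sub_pos, one_sub_Phi_eq_real]
  refine ENNReal.toReal_pos (fun h => ?_) (measure_ne_top _ _)
  have := gaussianReal_absolutelyContinuous' 0 (v := v.toNNReal) (by simpa using hv) h
  simp at this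

lemma Phi_neg (hv : 0 < v) (y : ℝ) : Phi v (-y) = 1 - Phi v y := by
  have hna := nullSingletonClass_gaussianReal (μ := 0) (v := v.toNNReal) (by simpa using hv)
  have hmap : (gaussianReal 0 v.toNNReal).map (fun x => -x) = gaussianReal 0 v.toNNReal := by
    rw [gaussianReal_map_neg, neg_zero]
  rw [one_sub_Phi_eq_real, Phi_eq_real]
  conv_lhs => rw [← hmap]
  rw [map_measureReal_apply measurable_neg measurableSet_Iic]
  have : (fun x : ℝ => -x) ⁻¹' Iic (-y) = Ici y := by ext x; simp
  rw [this, measureReal_congr Ioi_ae_eq_Ici.symm]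

/-- The crossing probability `1 - Φ(y)` for `y > 0` and `Φ(y)` for `y ≤ 0`. -/
noncomputable def crossPhi (v y : ℝ) : ℝ := if 0 < y then 1 - Phi v y else Phi v y

lemma crossPhi_pos (hv : 0 < v) (y : ℝ) : 0 < crossPhi v y := by
  unfold crossPhi
  split_ifs
  · linarith [Phi_lt_one hv y]
  · exact Phi_pos hv y

lemma crossPhi_lt_one (hv : 0 < v) (y : ℝ) : crossPhi v y < 1 := by
  unfold crossPhi
  split_ifs
  · linarith [Phi_pos hv y]
  · exact Phi_lt_one hv y

lemma measurable_crossPhi (v : ℝ) : Measurable (crossPhi v) :=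
  Measurable.ite measurableSet_Ioi ((monotone_Phi v).measurable.const_sub 1)
    (monotone_Phi v).measurable

lemma crossPhi_eq_one_sub_abs (hv : 0 < v) (y : ℝ) : crossPhi v y = 1 - Phi v |y| := by
  unfold crossPhi
  split_ifs with h
  · rw [abs_of_pos h]
  · rw [abs_of_nonpos (not_lt.1 h), Phi_neg hv, sub_sub_cancel]

/-- Chebyshev for `|y| ≥ 1` and the trivial bound elsewhere. -/
lemma crossPhi_le (hv : 0 < v) (y : ℝ) : crossPhi v y ≤ 2 * (1 + v) * (1 + y ^ 2)⁻¹ := by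
  rw [← div_eq_mul_inv, le_div_iff₀ (by positivity)]
  have h1 := (crossPhi_lt_one hv y).le
  have h0 := (crossPhi_pos hv y).le
  rcases le_total (y ^ 2) 1 with h | h
  · nlinarith
  have hy : 0 < |y| := by
    rw [← sq_abs] at h
    by_contra! h'
    have : |y| = 0 := le_antisymm h' (abs_nonneg y)
    norm_num [this] at h
  have hch := meas_ge_le_variance_div_sq (μ := gaussianReal 0 v.toNNReal)
    (memLp_id_gaussianReal 2) hy
  rw [variance_id_gaussianReal, Real.coe_toNNReal _ hv.le] at hch
  simp only [id, integral_id_gaussianReal, sub_zero, sq_abs] at hch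
  have h2 : crossPhi v y ≤ v / y ^ 2 := by
    rw [crossPhi_eq_one_sub_abs hv, one_sub_Phi_eq_real]
    refine ENNReal.toReal_le_of_le_ofReal (by positivity) (le_trans (measure_mono ?_) hch)
    intro x hx
    exact (le_of_lt hx).trans (le_abs_self x)
  rw [le_div_iff₀ (by positivity)] at h2
  nlinarith

lemma integrable_crossPhi (hv : 0 < v) : Integrable (crossPhi v) :=
  (integrable_inv_one_add_sq.const_mul (2 * (1 + v))).mono'
    (measurable_crossPhi v).aestronglyMeasurable
    (ae_of_all _ fun y => by
      rw [Real.norm_eq_abs, abs_of_pos (crossPhi_pos hv y)]; exact crossPhi_le hv y)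

end Phi

/-! ### Lattice sums as integrals -/

/-- Each site `k` owns the interval `((k-1)/N, k/N]`, so site sums divided by `N` are integrals. The
ceiling, rather than the floor, makes `k > 0` equivalent to `y > 0`, matching the strict inequality
in the definition of the current. -/
lemma map_ceil_volume {N : ℝ} (hN : 0 < N) :
    (volume : Measure ℝ).map (fun y => ⌈N * y⌉) = ENNReal.ofReal N⁻¹ • Measure.count := by
  have hm : Measurable fun y : ℝ => ⌈N * y⌉ := by fun_prop
  refine Measure.ext_of_singleton fun k => ?_
  rw [Measure.map_apply hm (measurableSet_singleton k), Measure.smul_apply,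
    Measure.count_singleton, smul_eq_mul, mul_one]
  have : (fun y : ℝ => ⌈N * y⌉) ⁻¹' {k} = Ioc ((k - 1) / N) (k / N) := by
    ext y
    simp only [mem_preimage, mem_singleton_iff, Int.ceil_eq_iff, mem_Ioc, div_lt_iff₀ hN,
      le_div_iff₀ hN, mul_comm N y]
  rw [this, Real.volume_Ioc]
  congr 1
  field_simp
  ring

lemma integrable_comp_ceil_iff {N : ℝ} (hN : 0 < N) {F : ℤ → ℝ} :
    Integrable (fun y : ℝ => F ⌈N * y⌉) ↔ Summable F := by
  have hm : Measurable fun y : ℝ => ⌈N * y⌉ := by fun_prop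
  have h := integrable_map_measure (μ := (volume : Measure ℝ)) (g := F)
    (measurable_of_int F).aestronglyMeasurable hm.aemeasurable
  rw [map_ceil_volume hN] at h
  refine h.symm.trans ?_
  rw [integrable_smul_measure (by simpa using hN) ENNReal.ofReal_ne_top,
    integrable_count_iff, summable_norm_iff]

lemma integral_comp_ceil {N : ℝ} (hN : 0 < N) {F : ℤ → ℝ} (hF : Summable F) :
    ∫ y : ℝ, F ⌈N * y⌉ = (∑' k, F k) / N := by
  have hm : Measurable fun y : ℝ => ⌈N * y⌉ := by fun_prop
  rw [← integral_map (φ := fun y : ℝ => ⌈N * y⌉) (f := F) hm.aemeasurable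
    (measurable_of_int F).aestronglyMeasurable, map_ceil_volume hN, integral_smul_measure,
    integral_countable (integrable_count_iff.2 (summable_norm_iff.2 hF))]
  simp only [measureReal_def, Measure.count_singleton, ENNReal.toReal_one, smul_eq_mul]
  rw [ENNReal.toReal_ofReal (by positivity)]
  field_simp

/-! ### Crossing probabilities -/

/-- Displacements taking a particle from relative position `k` across the characteristic, when
the characteristic is displaced by `b`. -/
def crossSet (b k : ℤ) : Set ℤ := if 0 < k then {z | k + z ≤ b} else {z | b < k + z}

/-- The crossing probability at time `n t` from the relative position `k`. -/
noncomputable def crossProb (p : PMF ℤ) (t : ℝ≥0) (n : ℕ) (k : ℤ) : ℝ :=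
  (displacementLaw p (n * t)).real (crossSet ⌊(n : ℝ) * drift p * t⌋ k)

lemma scaledLaw_real (p : PMF ℤ) (t : ℝ≥0) (n : ℕ) {S : Set ℝ} (hS : MeasurableSet S) :
    (scaledLaw p t n).real S
      = (displacementLaw p (n * t)).real {z : ℤ | ((z : ℝ) - n * drift p * t) / √(n : ℝ) ∈ S} := by
  rw [scaledLaw, map_measureReal_apply (measurable_of_int _) hS]; rfl

lemma crossProb_eq (p : PMF ℤ) (t : ℝ≥0) {n : ℕ} (hn : 0 < n) (k : ℤ) :
    crossProb p t n k =
      if 0 < k then (scaledLaw p t n).real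
          (Iic ((⌊(n : ℝ) * drift p * t⌋ - k - n * drift p * t) / √(n : ℝ)))
      else 1 - (scaledLaw p t n).real
          (Iic ((⌊(n : ℝ) * drift p * t⌋ - k - n * drift p * t) / √(n : ℝ))) := by
  have hN : 0 < √(n : ℝ) := Real.sqrt_pos.2 (by exact_mod_cast hn)
  have hset : {z : ℤ | ((z : ℝ) - n * drift p * t) / √(n : ℝ) ∈
      Iic ((⌊(n : ℝ) * drift p * t⌋ - k - n * drift p * t) / √(n : ℝ))}
      = {z : ℤ | k + z ≤ ⌊(n : ℝ) * drift p * t⌋} := by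
    ext z
    rw [mem_ofPred_eq, mem_Iic, div_le_div_iff_of_pos_right hN, sub_le_sub_iff_right,
      mem_ofPred_eq, add_comm, ← le_sub_iff_add_le]
    exact_mod_cast Iff.rfl
  rw [scaledLaw_real _ _ _ measurableSet_Iic, hset, crossProb, crossSet]
  split_ifs
  · rfl
  · rw [← probReal_compl_eq_one_sub MeasurableSet.of_discrete]
    congr 1
    ext z
    simp

/-- Monotonicity sandwiches the moving argument between fixed points. This is needed because
rounding makes the rescaled threshold only converge to `-y`. -/
lemma tendsto_cdf_of_tendsto {F : ℕ → ℝ → ℝ} {G : ℝ → ℝ} (hF : ∀ n, Monotone (F n))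
    (hG : Continuous G) (hlim : ∀ y, Tendsto (fun n => F n y) atTop (𝓝 (G y))) {u : ℕ → ℝ} {y : ℝ}
    (hu : Tendsto u atTop (𝓝 y)) : Tendsto (fun n => F n (u n)) atTop (𝓝 (G y)) := by
  rw [tendsto_order]
  constructor
  · intro c hc
    obtain ⟨z, hz, hzy⟩ := ((hG.continuousAt.eventually (lt_mem_nhds hc)).filter_mono
      nhdsWithin_le_nhds |>.and (self_mem_nhdsWithin (a := y) (s := Iio y))).exists
    filter_upwards [(hlim z).eventually (lt_mem_nhds hz), hu.eventually (lt_mem_nhds hzy)]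
      with n h1 h2
    exact h1.trans_le (hF n h2.le)
  · intro c hc
    obtain ⟨z, hz, hzy⟩ := ((hG.continuousAt.eventually (gt_mem_nhds hc)).filter_mono
      nhdsWithin_le_nhds |>.and (self_mem_nhdsWithin (a := y) (s := Ioi y))).exists
    filter_upwards [(hlim z).eventually (gt_mem_nhds hz), hu.eventually (gt_mem_nhds hzy)]
      with n h1 h2
    exact (hF n h2.le).trans_lt h1

section Kernel

variable {p : PMF ℤ} (hκ : 0 < secondMoment p) {t : ℝ≥0}
include hκ

lemma tendsto_crossProb (ht : 0 < t) (y : ℝ) :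
    Tendsto (fun n : ℕ => crossProb p t n ⌈√(n : ℝ) * y⌉) atTop
      (𝓝 (crossPhi (secondMoment p * t) y)) := by
  have hv : 0 < secondMoment p * t := mul_pos hκ ht
  have hu : Tendsto (fun n : ℕ => ((⌊(n : ℝ) * drift p * t⌋ - ⌈√(n : ℝ) * y⌉ - n * drift p * t)
      / √(n : ℝ) : ℝ)) atTop (𝓝 (-y)) := by
    rw [tendsto_iff_norm_sub_tendsto_zero]
    refine squeeze_zero' (g := fun n : ℕ => 2 / √(n : ℝ))
      (Eventually.of_forall fun _ => norm_nonneg _) ?_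
      (tendsto_const_nhds.div_atTop tendsto_sqrt_natCast_atTop)
    filter_upwards [eventually_gt_atTop 0] with n hn
    have hN : 0 < √(n : ℝ) := Real.sqrt_pos.2 (by exact_mod_cast hn)
    have h1 := Int.floor_le ((n : ℝ) * drift p * t)
    have h2 := Int.lt_floor_add_one ((n : ℝ) * drift p * t)
    have h3 := Int.le_ceil (√(n : ℝ) * y)
    have h4 := Int.ceil_lt_add_one (√(n : ℝ) * y)
    rw [show ((⌊(n : ℝ) * drift p * t⌋ - ⌈√(n : ℝ) * y⌉ - n * drift p * t) / √(n : ℝ) : ℝ) - -y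
      = (⌊(n : ℝ) * drift p * t⌋ - ⌈√(n : ℝ) * y⌉ - n * drift p * t + √(n : ℝ) * y) / √(n : ℝ) by
        field_simp; ring, Real.norm_eq_abs, abs_div, abs_of_pos hN]
    gcongr
    rw [abs_le]
    constructor <;> linarith
  have hmain := tendsto_cdf_of_tendsto
    (F := fun n x => (scaledLaw p t n).real (Iic x))
    (fun n a b hab => measureReal_mono (Iic_subset_Iic.2 hab)) (continuous_Phi hv)
    (tendsto_scaledLaw_Iic hκ ht) hu
  rw [Phi_neg hv] at hmain
  unfold crossPhi
  split_ifs with hy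
  · refine hmain.congr' ?_
    filter_upwards [eventually_gt_atTop 0] with n hn
    have hN : 0 < √(n : ℝ) := Real.sqrt_pos.2 (by exact_mod_cast hn)
    rw [crossProb_eq p t hn, if_pos (Int.ceil_pos.2 (by positivity))]
  · have h2 := hmain.const_sub 1
    rw [sub_sub_cancel] at h2
    refine h2.congr' ?_
    filter_upwards [eventually_gt_atTop 0] with n hn
    have hN : 0 < √(n : ℝ) := Real.sqrt_pos.2 (by exact_mod_cast hn)
    rw [crossProb_eq p t hn, if_neg]
    rw [Int.ceil_pos, not_lt]
    nlinarith

/-- For `|y| < 2` use `q ≤ 1` and `1 + y² < 5`. Otherwise a crossing forces a rescaled displacement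
above `|y| / 4`: rounding costs at most one lattice unit, while `√n |y| ≥ 2`. The tail bound is then
`48 · 16 κ₂ t / y²`, and `1 + y² ≤ (5/4) y²` turns 768 into 960. -/
lemma crossProb_le {n : ℕ} (hn : 0 < n) (y : ℝ) :
    crossProb p t n ⌈√(n : ℝ) * y⌉ ≤ (5 + 960 * (secondMoment p * t)) * (1 + y ^ 2)⁻¹ := by
  have hv : 0 ≤ secondMoment p * t := mul_nonneg hκ.le t.2
  have h1 : crossProb p t n ⌈√(n : ℝ) * y⌉ ≤ 1 := measureReal_le_one
  have h0 : 0 ≤ crossProb p t n ⌈√(n : ℝ) * y⌉ := measureReal_nonneg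
  have hn1 : (1 : ℝ) ≤ n := by exact_mod_cast hn
  have hN1 : 1 ≤ √(n : ℝ) := Real.one_le_sqrt.2 hn1
  have hN : 0 < √(n : ℝ) := by linarith
  rw [← div_eq_mul_inv, le_div_iff₀ (by positivity)]
  rcases lt_or_ge |y| 2 with hy | hy
  · have : y ^ 2 < 4 := by rw [← sq_abs]; nlinarith [abs_nonneg y]
    nlinarith
  have hy4 : 4 ≤ y ^ 2 := by rw [← sq_abs]; nlinarith [abs_nonneg y]
  have hsub : crossProb p t n ⌈√(n : ℝ) * y⌉
      ≤ (scaledLaw p t n).real {x | |y| / 4 < |x|} := by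
    rw [scaledLaw_real _ _ _ (measurableSet_lt measurable_const (by fun_prop)), crossProb]
    refine measureReal_mono fun z hz => ?_
    change |y| / 4 < |((z : ℝ) - n * drift p * t) / √(n : ℝ)|
    rw [abs_div, abs_of_pos hN, lt_div_iff₀ hN]
    have hf1 := Int.floor_le ((n : ℝ) * drift p * t)
    have hf2 := Int.lt_floor_add_one ((n : ℝ) * drift p * t)
    have hc1 := Int.le_ceil (√(n : ℝ) * y)
    have hc2 := Int.ceil_lt_add_one (√(n : ℝ) * y)
    unfold crossSet at hz
    split_ifs at hz with hk
    · have hy0 : 0 < y := by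
        by_contra! h
        exact absurd (Int.ceil_pos.1 hk) (not_lt.2 (by nlinarith))
      rw [abs_of_pos hy0] at hy ⊢
      have hz' : (⌈√(n : ℝ) * y⌉ : ℝ) + z ≤ ⌊(n : ℝ) * drift p * t⌋ := by exact_mod_cast hz
      refine lt_of_lt_of_le ?_ (neg_le_abs _)
      nlinarith
    · have hy0 : y ≤ 0 := by
        by_contra! h
        exact hk (Int.ceil_pos.2 (by positivity))
      rw [abs_of_nonpos hy0] at hy ⊢
      have hz' : (⌊(n : ℝ) * drift p * t⌋ : ℝ) + 1 ≤ ⌈√(n : ℝ) * y⌉ + z := by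
        exact_mod_cast Int.add_one_le_iff.2 hz
      refine lt_of_lt_of_le ?_ (le_abs_self _)
      nlinarith
  have h2 := hsub.trans (tail_scaledLaw_le hκ t hn (r := |y| / 4) (by linarith))
  rw [div_pow, sq_abs, le_div_iff₀ (by positivity)] at h2
  nlinarith

lemma summable_crossProb {n : ℕ} (hn : 0 < n) : Summable (crossProb p t n) := by
  have hN : 0 < √(n : ℝ) := Real.sqrt_pos.2 (by exact_mod_cast hn)
  rw [← integrable_comp_ceil_iff hN]
  refine (integrable_inv_one_add_sq.const_mul (5 + 960 * (secondMoment p * t))).mono'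
    ((measurable_of_int (crossProb p t n)).comp (by fun_prop)).aestronglyMeasurable
    (ae_of_all _ fun y => ?_)
  rw [Real.norm_eq_abs, abs_of_nonneg (show 0 ≤ crossProb p t n _ from measureReal_nonneg)]
  exact crossProb_le hκ hn y

end Kernel

/-! ### The current as a signed count of crossings -/

/-- The sign of the contribution to the current of particles started at relative position `k`. -/
def side (k : ℤ) : ℝ := if 0 < k then 1 else -1

lemma abs_side (k : ℤ) : |side k| = 1 := by
  unfold side; split_ifs <;> simp

/-- The two indicators in the current exclude each other, and the starting side decides which of
them can be nonzero. -/
lemma current_eq_tsum_hits {Ω : Type*} (p : PMF ℤ) (η : ℤ → Ω → ℕ)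
    (ξ : ℤ × ℕ → ℝ≥0 → Ω → ℤ) (n : ℕ) (t : ℝ≥0) (r : ℝ) (ω : Ω) :
    current p η ξ n t r ω = ∑' m, side (m - ⌊r * √(n : ℝ)⌋) *
      hits η (fun a => ξ a (n * t))
        (fun m => crossSet ⌊(n : ℝ) * drift p * t⌋ (m - ⌊r * √(n : ℝ)⌋)) m ω := by
  unfold current hits
  congr 1 with m
  rw [Finset.mul_sum]
  refine Finset.sum_congr rfl fun j _ => ?_
  dsimp only
  generalize ξ (m, j) (n * t) ω = z
  generalize ⌊r * √(n : ℝ)⌋ = a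
  generalize ⌊(n : ℝ) * drift p * t⌋ = b
  by_cases hm : a < m
  · have h0 : 0 < m - a := by omega
    have h1 : ¬ m ≤ a := by omega
    by_cases hz : m + z ≤ b + a
    · have h2 : m - a + z ≤ b := by omega
      simp [side, crossSet, hm, h1, hz, h2]
    · have h2 : ¬ m - a + z ≤ b := by omega
      simp [side, crossSet, hm, h1, hz, h2]
  · have h0 : ¬ 0 < m - a := by omega
    have h1 : m ≤ a := by omega
    by_cases hz : b + a < m + z
    · have h2 : b < m - a + z := by omega
      simp [side, crossSet, hm, h1, hz, h2]
    · have h2 : ¬ b < m - a + z := by omega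
      simp [side, crossSet, hm, h1, hz, h2]

/-! ### Convergence of the scaled cumulant generating functions -/

lemma IsLogPGF.gam_eq {ν : Measure ℕ} {g : ℝ → ℝ} (hg : IsLogPGF ν g) (θ : ℝ) :
    gam ν θ = g (Real.exp θ) := by
  rw [gam, cgf, mgf, integral_eq_lintegral_of_nonneg_ae (ae_of_all _ fun _ => (Real.exp_pos _).le)
    measurable_from_top.aestronglyMeasurable]
  have h : ∀ k : ℕ, ENNReal.ofReal (Real.exp (θ * k)) = ENNReal.ofReal (Real.exp θ) ^ k := by
    intro k
    rw [← ENNReal.ofReal_pow (Real.exp_pos _).le, ← Real.exp_nat_mul, mul_comm]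
  simp_rw [h]
  rw [hg.lintegral_pow _ (Real.exp_pos θ), ENNReal.toReal_ofReal (Real.exp_pos _).le, Real.log_exp]

/-- `side` as a function of a real position. -/
noncomputable def sideReal (y : ℝ) : ℝ := if 0 < y then 1 else -1

lemma abs_sideReal (y : ℝ) : |sideReal y| = 1 := by
  unfold sideReal; split_ifs <;> simp

lemma side_ceil {N : ℝ} (hN : 0 < N) (y : ℝ) : side ⌈N * y⌉ = sideReal y := by
  unfold side sideReal
  simp only [Int.ceil_pos, mul_pos_iff_of_pos_left hN]

/-- `exp (Z_l(y))`. -/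
noncomputable def expZ (v l y : ℝ) : ℝ := 1 + (Real.exp (l * sideReal y) - 1) * crossPhi v y

lemma exp_neg_abs_le_expZ {v : ℝ} (hv : 0 < v) (l y : ℝ) : Real.exp (-|l|) ≤ expZ v l y := by
  have := one_add_mul_ge (c := l * sideReal y) (crossPhi_pos hv y).le (crossPhi_lt_one hv y).le
  rwa [abs_mul, abs_sideReal, mul_one] at this

lemma expZ_pos {v : ℝ} (hv : 0 < v) (l y : ℝ) : 0 < expZ v l y :=
  (Real.exp_pos _).trans_le (exp_neg_abs_le_expZ hv l y)

lemma Zfun_eq (v l y : ℝ) : Zfun v l y = Real.log (expZ v l y) := by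
  unfold Zfun expZ crossPhi sideReal
  split_ifs
  · congr 1; ring_nf
  · congr 1; ring_nf

lemma IsLogPGF.gam_Zfun {ν : Measure ℕ} {g : ℝ → ℝ} (hg : IsLogPGF ν g) {v : ℝ} (hv : 0 < v)
    (l y : ℝ) : gam ν (Zfun v l y) = g (expZ v l y) := by
  rw [hg.gam_eq, Zfun_eq, Real.exp_log (expZ_pos hv l y)]

lemma abs_exp_mul_sub_one_le {l s : ℝ} (hs : |s| = 1) :
    |Real.exp (l * s) - 1| ≤ Real.exp |l| + 1 := by
  have h1 : Real.exp (l * s) ≤ Real.exp |l| :=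
    Real.exp_le_exp.2 ((le_abs_self _).trans (by rw [abs_mul, hs, mul_one]))
  rw [abs_le]
  constructor <;> linarith [Real.exp_pos (l * s), Real.exp_pos |l|]

lemma measurable_sideReal : Measurable sideReal :=
  Measurable.ite measurableSet_Ioi measurable_const measurable_const

lemma measurable_expZ (v l : ℝ) : Measurable (expZ v l) :=
  (((Real.measurable_exp.comp (measurable_sideReal.const_mul l)).sub_const 1).mul
    (measurable_crossPhi v)).const_add 1

lemma IsLogPGF.integrable_gam_Zfun {ν : Measure ℕ} {g : ℝ → ℝ} (hg : IsLogPGF ν g) {v : ℝ}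
    (hv : 0 < v) (l : ℝ) : Integrable fun y => gam ν (Zfun v l y) := by
  simp_rw [hg.gam_Zfun hv]
  obtain ⟨M, hM0, hM⟩ := hg.bound _ (Real.exp_pos (-|l|))
  refine ((integrable_crossPhi hv).const_mul (M * (Real.exp |l| + 1))).mono' ?_
    (ae_of_all _ fun y => ?_)
  -- Since `g` is continuous only on the positive half-line, measurability is obtained by factoring
  -- through the subtype.
  · have h1 : Measurable fun y => (⟨expZ v l y, expZ_pos hv l y⟩ : Ioi (0 : ℝ)) :=
      (measurable_expZ v l).subtype_mk
    exact ((continuousOn_iff_continuous_domRestrict.1 hg.continuousOn).measurable.comp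
      h1).aestronglyMeasurable
  · refine (hM _ (exp_neg_abs_le_expZ hv l y)).trans ?_
    rw [expZ, add_sub_cancel_left, abs_mul, abs_of_pos (crossPhi_pos hv y), mul_assoc]
    have := abs_exp_mul_sub_one_le (l := l) (abs_sideReal y)
    have := (crossPhi_pos hv y).le
    gcongr

section Current

variable {Ω : Type*} [MeasurableSpace Ω] {P : Measure Ω} [IsProbabilityMeasure P] {ν : Measure ℕ}
  {g : ℝ → ℝ} {p : PMF ℤ} {η : ℤ → Ω → ℕ} {ξ : ℤ × ℕ → ℝ≥0 → Ω → ℤ}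

lemma IsWalkSystem.cgf_current (h : IsWalkSystem p ν P η ξ) (hg : IsLogPGF ν g)
    (hκ : 0 < secondMoment p) {n : ℕ} (hn : 0 < n) (t : ℝ≥0) (r : ℝ) :
    AEMeasurable (current p η ξ n t r) P ∧
    (∀ l, Integrable (fun ω => Real.exp (l * current p η ξ n t r ω)) P) ∧
    ∀ l, cgf (current p η ξ n t r) P l / √(n : ℝ)
      = ∫ y, g (1 + (Real.exp (l * sideReal y) - 1) * crossProb p t n ⌈√(n : ℝ) * y⌉) := by
  have hN : 0 < √(n : ℝ) := Real.sqrt_pos.2 (by exact_mod_cast hn)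
  have hs := summable_crossProb hκ (t := t) hn
  have hcur := funext (current_eq_tsum_hits p η ξ n t r)
  have hA : Summable fun m => (displacementLaw p (n * t)).real
      (crossSet ⌊(n : ℝ) * drift p * t⌋ (m - ⌊r * √(n : ℝ)⌋)) :=
    hs.comp_injective (Equiv.subRight ⌊r * √(n : ℝ)⌋).injective
  have key := (h.isMarkedSystem (n * t)).cgf_tsum_signed_hits hg hA
    (s := fun m => side (m - ⌊r * √(n : ℝ)⌋)) fun m => abs_side _
  rw [← hcur] at key
  refine ⟨key.1, fun l => ?_, fun l => ?_⟩
  · have := key.2.1 l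
    simp_rw [← current_eq_tsum_hits] at this
    exact this
  have hsum := hg.summable hs (fun m => measureReal_nonneg) (fun m => measureReal_le_one)
    (c := fun m => l * side m) (C := |l|) fun m => by rw [abs_mul, abs_side, mul_one]
  have hint := integral_comp_ceil hN hsum
  simp_rw [side_ceil hN] at hint
  rw [key.2.2 l, hint]
  congr 1
  exact (Equiv.subRight ⌊r * √(n : ℝ)⌋).tsum_eq
    fun k => g (1 + (Real.exp (l * side k) - 1) * crossProb p t n k)

end Current

lemma IsLogPGF.tendsto_integral {ν : Measure ℕ} {g : ℝ → ℝ} (hg : IsLogPGF ν g) {p : PMF ℤ}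
    (hκ : 0 < secondMoment p) {t : ℝ≥0} (ht : 0 < t) (l : ℝ) :
    Tendsto (fun n : ℕ => ∫ y, g (1 + (Real.exp (l * sideReal y) - 1) *
      crossProb p t n ⌈√(n : ℝ) * y⌉)) atTop (𝓝 (Lam ν (secondMoment p * t) l)) := by
  have hv : 0 < secondMoment p * t := mul_pos hκ ht
  unfold Lam
  simp_rw [hg.gam_Zfun hv]
  obtain ⟨M, hM0, hM⟩ := hg.bound _ (Real.exp_pos (-|l|))
  have hlow : ∀ (n : ℕ) y, Real.exp (-|l|) ≤ 1 + (Real.exp (l * sideReal y) - 1) *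
      crossProb p t n ⌈√(n : ℝ) * y⌉ := fun n y => by
    have := one_add_mul_ge (c := l * sideReal y) (q := crossProb p t n ⌈√(n : ℝ) * y⌉)
      measureReal_nonneg measureReal_le_one
    rwa [abs_mul, abs_sideReal, mul_one] at this
  refine tendsto_integral_filter_of_dominated_convergence
    (fun y => M * (Real.exp |l| + 1) * ((5 + 960 * (secondMoment p * t)) * (1 + y ^ 2)⁻¹)) ?_ ?_
    ((integrable_inv_one_add_sq.const_mul _).const_mul _) (ae_of_all _ fun y => ?_)
  · refine Eventually.of_forall fun n => ?_
    have h0 : Measurable fun y => 1 + (Real.exp (l * sideReal y) - 1) *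
        crossProb p t n ⌈√(n : ℝ) * y⌉ :=
      (((Real.measurable_exp.comp (measurable_sideReal.const_mul l)).sub_const 1).mul
        ((measurable_of_int (crossProb p t n)).comp (by fun_prop))).const_add 1
    have h1 : Measurable fun y => (⟨_, (Real.exp_pos _).trans_le (hlow n y)⟩ : Ioi (0 : ℝ)) :=
      h0.subtype_mk
    exact ((continuousOn_iff_continuous_domRestrict.1 hg.continuousOn).measurable.comp
      h1).aestronglyMeasurable
  · filter_upwards [eventually_gt_atTop 0] with n hn
    refine ae_of_all _ fun y => ?_
    refine (hM _ (hlow n y)).trans ?_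
    have hq : 0 ≤ crossProb p t n ⌈√(n : ℝ) * y⌉ := measureReal_nonneg
    rw [add_sub_cancel_left, abs_mul, abs_of_nonneg hq, mul_assoc]
    have h1 := abs_exp_mul_sub_one_le (l := l) (abs_sideReal y)
    have h2 := crossProb_le hκ (t := t) hn y
    gcongr
  · have hcont := hg.continuousOn.continuousAt (Ioi_mem_nhds (expZ_pos hv l y))
    exact hcont.tendsto.comp (((tendsto_crossProb hκ ht y).const_mul _).const_add 1)

/-- Everything common to the two occupation laws: only the derivative of `Λ`, its monotonicity and
range, and the Legendre identity along `x = L' l` remain to be supplied. -/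
theorem isCurrentRate_of_deriv {Ω : ℕ → Type*} [∀ n, MeasurableSpace (Ω n)]
    {P : ∀ n, Measure (Ω n)} [∀ n, IsProbabilityMeasure (P n)] {p : PMF ℤ}
    (hκ : 0 < secondMoment p) {η : ∀ n, ℤ → Ω n → ℕ} {ξ : ∀ n, ℤ × ℕ → ℝ≥0 → Ω n → ℤ}
    {t : ℝ≥0} (ht : 0 < t) (r : ℝ) {ν : Measure ℕ} {g : ℝ → ℝ} (hg : IsLogPGF ν g)
    (hsys : ∀ n, 1 ≤ n → IsWalkSystem p ν (P n) (η n) (ξ n)) {L' I : ℝ → ℝ}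
    (hL : ∀ l, HasDerivAt (Lam ν (secondMoment p * t)) (L' l) l) (hmono : Monotone L')
    (hsurj : Function.Surjective L')
    (hI : ∀ l, I (L' l) = l * L' l - Lam ν (secondMoment p * t) l) :
    IsCurrentRate p ν P η ξ t r I := by
  have hv : 0 < secondMoment p * t := mul_pos hκ ht
  have hlub : ∀ x, IsLUB (range fun l : ℝ => l * x - Lam ν (secondMoment p * t) l) (I x) := by
    intro x
    obtain ⟨l, rfl⟩ := hsurj x
    rw [hI]
    exact isLUB_dual_of_deriv hL hmono l
  have h0 : Lam ν (secondMoment p * t) 0 = 0 := by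
    unfold Lam
    simp_rw [hg.gam_Zfun hv]
    obtain ⟨M, -, hM⟩ := hg.bound 1 one_pos
    have : g 1 = 0 := by simpa using hM 1 le_rfl
    simp [expZ, this]
  have hcur := fun n (hn : 0 < n) => (hsys n hn).cgf_current hg hκ hn t r
  refine ⟨satisfiesLDP_of_tendsto_cgf (Y := fun n => current p (η n) (ξ n) n t r)
    ?_ ?_ (fun l => ?_) hL hmono hsurj h0 hlub, isGoodRate_of_isLUB h0 hlub,
    hg.integrable_gam_Zfun hv, hlub⟩
  · filter_upwards [eventually_gt_atTop 0] with n hn using (hcur n hn).1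
  · filter_upwards [eventually_gt_atTop 0] with n hn using (hcur n hn).2.1
  · refine (hg.tendsto_integral hκ ht l).congr' ?_
    filter_upwards [eventually_gt_atTop 0] with n hn using ((hcur n hn).2.2 l).symm

/-! ### Poisson occupations -/

lemma isLogPGF_poissonMeasure (ρ : ℝ≥0) :
    IsLogPGF (poissonMeasure ρ) fun u => ρ * (u - 1) where
  lintegral_pow u hu := by
    have hexp := (NormedSpace.expSeries_div_hasSum_exp (𝔸 := ℝ) (ρ * u)).mul_left (Real.exp (-ρ))
    rw [← Real.exp_eq_exp_ℝ, ← Real.exp_add] at hexp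
    have hexp' : HasSum (fun n : ℕ => Real.exp (-ρ) * ρ ^ n / (n.factorial : ℝ) * u ^ n)
        (Real.exp (ρ * (u - 1))) := by
      convert! hexp using 1
      · ext n; rw [mul_pow]; ring
      · congr 1; ring
    have hint : Integrable (fun k : ℕ => u ^ k) (poissonMeasure ρ) := by
      rw [integrable_poissonMeasure_iff]
      refine hexp'.summable.congr fun n => ?_
      rw [Real.norm_eq_abs, abs_of_pos (by positivity)]
    simp_rw [← ENNReal.ofReal_pow hu.le]
    rw [← ofReal_integral_eq_lintegral_ofReal hint (ae_of_all _ fun k => by positivity),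
      integral_poissonMeasure]
    simp_rw [smul_eq_mul]
    rw [hexp'.tsum_eq]
  continuousOn := by fun_prop
  bound ε _ := ⟨ρ, ρ.2, fun u _ => by rw [abs_mul, abs_of_nonneg ρ.coe_nonneg]⟩

lemma integral_Ioi_mul_exp_neg_sq {v : ℝ} (hv : 0 < v) :
    ∫ x in Ioi (0 : ℝ), x * Real.exp (-x ^ 2 / (2 * v)) = v := by
  have h := integral_mul_cexp_neg_mul_sq (b := (((2 * v)⁻¹ : ℝ) : ℂ))
    (by rw [Complex.ofReal_re]; positivity)
  have h2 : ∀ x : ℝ, (x : ℂ) * Complex.exp (-(((2 * v)⁻¹ : ℝ) : ℂ) * (x : ℂ) ^ 2)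
      = ((x * Real.exp (-x ^ 2 / (2 * v)) : ℝ) : ℂ) := by
    intro x
    push_cast
    congr 2
    ring
  simp_rw [h2] at h
  rw [integral_complex_ofReal] at h
  have h3 : (2 * (((2 * v)⁻¹ : ℝ) : ℂ))⁻¹ = ((v : ℝ) : ℂ) := by
    have : (v : ℂ) ≠ 0 := by exact_mod_cast hv.ne'
    push_cast
    field_simp
  rw [h3] at h
  exact_mod_cast h

/-- By the layer-cake formula the integral is the mean of the positive part of the Gaussian, which
is elementary. -/
lemma integral_one_sub_Phi {v : ℝ} (hv : 0 < v) :
    ∫ y in Ioi (0 : ℝ), (1 - Phi v y) = √(v / (2 * Real.pi)) := by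
  have hv' : v.toNNReal ≠ 0 := by simpa using hv
  have hint : Integrable (fun x : ℝ => max x 0) (gaussianReal 0 v.toNNReal) :=
    ((memLp_id_gaussianReal (μ := 0) (v := v.toNNReal) 1).integrable le_rfl).pos_part
  have hlayer := hint.integral_eq_integral_meas_lt (ae_of_all _ fun x => le_max_right _ _)
  have h1 : ∫ y in Ioi (0 : ℝ), (1 - Phi v y)
      = ∫ t in Ioi (0 : ℝ), (gaussianReal 0 v.toNNReal).real {a | t < max a 0} := by
    refine setIntegral_congr_fun measurableSet_Ioi fun t ht => ?_
    have ht : 0 < t := ht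
    simp only [one_sub_Phi_eq_real]
    congr 1
    ext a
    simp [ht.not_gt]
  rw [h1, ← hlayer, integral_gaussianReal_eq_integral_smul hv']
  have h2 : ∀ x : ℝ, gaussianPDFReal 0 v.toNNReal x • max x 0
      = (Ioi (0 : ℝ)).indicator
        (fun x => (√(2 * Real.pi * v))⁻¹ * (x * Real.exp (-x ^ 2 / (2 * v)))) x := by
    intro x
    rw [gaussianPDFReal, Real.coe_toNNReal _ hv.le, smul_eq_mul, sub_zero]
    by_cases hx : 0 < x
    · rw [indicator_of_mem (by exact hx), max_eq_left hx.le]; ring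
    · rw [indicator_of_notMem (by exact hx), max_eq_right (not_lt.1 hx), mul_zero]
  simp_rw [h2]
  rw [integral_indicator measurableSet_Ioi, integral_const_mul, integral_Ioi_mul_exp_neg_sq hv]
  have h3 : √(v / (2 * Real.pi)) * √(2 * Real.pi * v) = v := by
    rw [← Real.sqrt_mul (by positivity), show v / (2 * Real.pi) * (2 * Real.pi * v) = v * v by
      field_simp, Real.sqrt_mul_self hv.le]
  have h4 : 0 < √(2 * Real.pi * v) := Real.sqrt_pos.2 (by positivity)
  rw [inv_mul_eq_div, div_eq_iff h4.ne', h3]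

lemma integral_Phi {v : ℝ} (hv : 0 < v) :
    ∫ y in Iic (0 : ℝ), Phi v y = √(v / (2 * Real.pi)) := by
  have := integral_comp_neg_Ioi 0 (Phi v)
  rw [neg_zero] at this
  rw [← this, ← integral_one_sub_Phi hv]
  simp_rw [Phi_neg hv]

lemma integral_eq_Iic_add_Ioi {f : ℝ → ℝ} (hf : Integrable f) :
    ∫ y, f y = (∫ y in Iic (0 : ℝ), f y) + ∫ y in Ioi (0 : ℝ), f y := by
  rw [← integral_add_compl measurableSet_Iic hf, compl_Iic]

lemma Lam_poissonMeasure (ρ : ℝ≥0) {v : ℝ} (hv : 0 < v) (l : ℝ) :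
    Lam (poissonMeasure ρ) v l = ρ * √(2 * v / Real.pi) * (Real.cosh l - 1) := by
  have hg := isLogPGF_poissonMeasure ρ
  have hint := hg.integrable_gam_Zfun hv l
  rw [Lam, integral_eq_Iic_add_Ioi hint]
  simp_rw [hg.gam_Zfun hv]
  have h1 : ∫ y in Iic (0 : ℝ), (ρ : ℝ) * (expZ v l y - 1)
      = ρ * (Real.exp (-l) - 1) * √(v / (2 * Real.pi)) := by
    rw [← integral_Phi hv, ← integral_const_mul]
    refine setIntegral_congr_fun measurableSet_Iic fun y hy => ?_
    have hy : ¬ 0 < y := not_lt.2 hy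
    simp only [expZ, sideReal, crossPhi, if_neg hy, mul_neg, mul_one]
    ring
  have h2 : ∫ y in Ioi (0 : ℝ), (ρ : ℝ) * (expZ v l y - 1)
      = ρ * (Real.exp l - 1) * √(v / (2 * Real.pi)) := by
    rw [← integral_one_sub_Phi hv, ← integral_const_mul]
    refine setIntegral_congr_fun measurableSet_Ioi fun y hy => ?_
    have hy : 0 < y := hy
    simp only [expZ, sideReal, crossPhi, if_pos hy, mul_one]
    ring
  have h3 : √(2 * v / Real.pi) = 2 * √(v / (2 * Real.pi)) := by
    rw [show 2 * v / Real.pi = 2 ^ 2 * (v / (2 * Real.pi)) by field_simp,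
      Real.sqrt_mul (by norm_num), Real.sqrt_sq (by norm_num)]
  rw [h1, h2, h3, Real.cosh_eq]
  ring

/-- With `x` a multiple of `sinh l`, the square root becomes `cosh l` and the logarithm becomes `log
(sinh l + cosh l) = l`. -/
lemma poissonRate_mul_sinh {ρ v : ℝ} (hρ : 0 < ρ) (hv : 0 < v) (l : ℝ) :
    poissonRate ρ v (ρ * √(2 * v / Real.pi) * Real.sinh l)
      = l * (ρ * √(2 * v / Real.pi) * Real.sinh l)
        - ρ * √(2 * v / Real.pi) * (Real.cosh l - 1) := by
  have hpi := Real.pi_pos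
  have h2v : 0 < √(2 * v) := Real.sqrt_pos.2 (by positivity)
  have hspi : 0 < √Real.pi := Real.sqrt_pos.2 hpi
  have e1 : ρ * √(2 * v / Real.pi) * Real.sinh l * √Real.pi / (ρ * √(2 * v)) = Real.sinh l := by
    rw [Real.sqrt_div (by positivity)]
    field_simp
  have e2 : 1 + (ρ * √(2 * v / Real.pi) * Real.sinh l) ^ 2 * Real.pi / (2 * ρ ^ 2 * v)
      = Real.cosh l ^ 2 := by
    rw [mul_pow, mul_pow, Real.sq_sqrt (by positivity), Real.cosh_sq]
    field_simp
    ring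
  rw [poissonRate, e1, e2, Real.sqrt_sq (Real.cosh_pos l).le, Real.sinh_add_cosh, Real.log_exp]
  ring

/-! ### One particle per site -/

lemma isLogPGF_dirac_one : IsLogPGF (Measure.dirac 1) Real.log where
  lintegral_pow u hu := by rw [lintegral_dirac, pow_one, Real.exp_log hu]
  continuousOn := Real.continuousOn_log.mono fun _ hx => (ne_of_gt hx : _ ≠ _)
  bound ε hε := by
    -- From `1 - u⁻¹ ≤ log u ≤ u - 1`, where `1 - u⁻¹ = (u - 1) u⁻¹` and `u⁻¹ ≤ ε⁻¹`.
    refine ⟨1 + ε⁻¹, by positivity, fun u hu => ?_⟩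
    have hu0 : 0 < u := hε.trans_le hu
    have h1 := Real.log_le_sub_one_of_pos hu0
    have h2 := Real.one_sub_inv_le_log_of_pos hu0
    have h3 : 1 - u⁻¹ = (u - 1) * u⁻¹ := by field_simp
    have h4 : u⁻¹ ≤ ε⁻¹ := inv_anti₀ hε hu
    have h5 : |(u - 1) * u⁻¹| ≤ |u - 1| * ε⁻¹ := by
      rw [abs_mul, abs_of_pos (inv_pos.2 hu0)]; gcongr
    have h6 := neg_abs_le ((u - 1) * u⁻¹)
    have h7 := le_abs_self (u - 1)
    have h8 : 0 < ε⁻¹ := inv_pos.2 hε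
    have h9 := abs_nonneg (u - 1)
    rw [abs_le]
    constructor <;> nlinarith

/-- The density of `tiltedCurrent`, which is the derivative of `log (expZ v l y)` in `l`. -/
noncomputable def currentDensity (v l y : ℝ) : ℝ :=
  sideReal y * (Real.exp (l * sideReal y) * crossPhi v y / expZ v l y)

section

variable {v : ℝ} (hv : 0 < v)
include hv

lemma Phi_add_exp_mul_pos (a y : ℝ) : 0 < Phi v y + Real.exp a * (1 - Phi v y) :=
  add_pos (Phi_pos hv y) (mul_pos (Real.exp_pos a) (sub_pos.2 (Phi_lt_one hv y)))

lemma Ftilt_eq (a y : ℝ) :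
    Ftilt v a y = Phi v y / (Phi v y + Real.exp a * (1 - Phi v y)) := by
  have h0 : 0 < 1 - Phi v y + Real.exp (-a) * Phi v y :=
    add_pos (sub_pos.2 (Phi_lt_one hv y)) (mul_pos (Real.exp_pos _) (Phi_pos hv y))
  have hee : Real.exp a * Real.exp (-a) = 1 := by rw [← Real.exp_add]; simp
  rw [Ftilt, div_eq_div_iff h0.ne' (Phi_add_exp_mul_pos hv a y).ne']
  linear_combination Phi v y * (1 - Phi v y) * hee

lemma one_sub_Ftilt_eq (a y : ℝ) :
    1 - Ftilt v a y = Real.exp a * (1 - Phi v y) / (Phi v y + Real.exp a * (1 - Phi v y)) := by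
  rw [Ftilt_eq hv, eq_div_iff (Phi_add_exp_mul_pos hv a y).ne', sub_mul,
    div_mul_cancel₀ _ (Phi_add_exp_mul_pos hv a y).ne']
  ring

lemma currentDensity_of_pos {y : ℝ} (hy : 0 < y) (l : ℝ) :
    currentDensity v l y = 1 - Ftilt v l y := by
  rw [one_sub_Ftilt_eq hv, currentDensity, expZ, crossPhi, sideReal, if_pos hy, if_pos hy, mul_one,
    one_mul]
  congr 1
  ring

omit hv in
lemma currentDensity_of_nonpos {y : ℝ} (hy : y ≤ 0) (l : ℝ) :
    currentDensity v l y = -Ftilt v l y := by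
  rw [currentDensity, expZ, crossPhi, sideReal, Ftilt, if_neg (not_lt.2 hy), if_neg (not_lt.2 hy),
    mul_neg, mul_one, neg_one_mul]
  congr 2
  ring

/-- One factor `e^{|l|}` comes from the numerator, the other from the lower bound on `expZ`. Local
uniformity in `l` allows differentiation under the integral. -/
lemma abs_currentDensity_le (l y : ℝ) :
    |currentDensity v l y| ≤ Real.exp (2 * |l|) * crossPhi v y := by
  have hq := crossPhi_pos hv y
  have h1 := exp_neg_abs_le_expZ hv l y
  have h2 : Real.exp (l * sideReal y) ≤ Real.exp |l| :=
    Real.exp_le_exp.2 ((le_abs_self _).trans (by rw [abs_mul, abs_sideReal, mul_one]))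
  rw [currentDensity, abs_mul, abs_sideReal, one_mul, abs_div, abs_of_pos (expZ_pos hv l y),
    abs_mul, abs_of_pos hq, abs_of_pos (Real.exp_pos _), div_le_iff₀ (expZ_pos hv l y)]
  calc Real.exp (l * sideReal y) * crossPhi v y ≤ Real.exp |l| * crossPhi v y := by gcongr
    _ = Real.exp (2 * |l|) * crossPhi v y * Real.exp (-|l|) := by
        rw [mul_right_comm, ← Real.exp_add]; congr 2; ring
    _ ≤ _ := by gcongr

omit hv in
lemma measurable_currentDensity (v l : ℝ) : Measurable (currentDensity v l) :=
  measurable_sideReal.mul (((Real.measurable_exp.comp (measurable_sideReal.const_mul l)).mul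
    (measurable_crossPhi v)).div (measurable_expZ v l))

lemma integrable_currentDensity (l : ℝ) : Integrable (currentDensity v l) :=
  ((integrable_crossPhi hv).const_mul (Real.exp (2 * |l|))).mono'
    (measurable_currentDensity v l).aestronglyMeasurable
    (ae_of_all _ fun y => abs_currentDensity_le hv l y)

lemma integrableOn_one_sub_Ftilt (a : ℝ) :
    IntegrableOn (fun y => 1 - Ftilt v a y) (Ioi 0) :=
  (integrable_currentDensity hv a).integrableOn.congr_fun
    (fun _ hy => currentDensity_of_pos hv hy a) measurableSet_Ioi

lemma integrableOn_Ftilt (a : ℝ) : IntegrableOn (fun y => Ftilt v a y) (Iic 0) :=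
  (integrable_currentDensity hv a).integrableOn.neg.congr_fun
    (fun y hy => by
      simp only [Pi.neg_apply, currentDensity_of_nonpos hy, neg_neg]) measurableSet_Iic

lemma tiltedCurrent_eq_integral (a : ℝ) : tiltedCurrent v a = ∫ y, currentDensity v a y := by
  rw [integral_eq_Iic_add_Ioi (integrable_currentDensity hv a), tiltedCurrent,
    setIntegral_congr_fun (g := fun y => 1 - Ftilt v a y) measurableSet_Ioi
      (fun y hy => currentDensity_of_pos hv hy a),
    setIntegral_congr_fun (g := fun y => -Ftilt v a y) measurableSet_Iic
      (fun y hy => currentDensity_of_nonpos hy a), integral_neg]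
  ring

lemma hasDerivAt_log_expZ (l y : ℝ) :
    HasDerivAt (fun l => Real.log (expZ v l y)) (currentDensity v l y) l := by
  have h1 : HasDerivAt (fun l => expZ v l y)
      (Real.exp (l * sideReal y) * (1 * sideReal y) * crossPhi v y) l :=
    ((((hasDerivAt_id l).mul_const (sideReal y)).exp.sub_const 1).mul_const
      (crossPhi v y)).const_add 1
  convert! h1.log (expZ_pos hv l y).ne' using 1
  rw [currentDensity]; ring

lemma hasDerivAt_Lam_dirac_one (l : ℝ) :
    HasDerivAt (Lam (Measure.dirac 1) v) (tiltedCurrent v l) l := by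
  have hg := isLogPGF_dirac_one
  have hL : Lam (Measure.dirac 1) v = fun l => ∫ y, Real.log (expZ v l y) := by
    ext l
    rw [Lam]
    simp_rw [hg.gam_Zfun hv]
  have hint : ∀ l, Integrable fun y => Real.log (expZ v l y) := fun l => by
    have := hg.integrable_gam_Zfun hv l
    simp_rw [hg.gam_Zfun hv] at this
    exact this
  rw [hL, tiltedCurrent_eq_integral hv]
  refine (hasDerivAt_integral_of_dominated_loc_of_deriv_le (Metric.ball_mem_nhds l one_pos)
    (Eventually.of_forall fun x => (hint x).aestronglyMeasurable) (hint l)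
    (measurable_currentDensity v l).aestronglyMeasurable
    (bound := fun y => Real.exp (2 * (|l| + 1)) * crossPhi v y) (ae_of_all _ fun y x hx => ?_)
    ((integrable_crossPhi hv).const_mul _)
    (ae_of_all _ fun y x _ => hasDerivAt_log_expZ hv x y)).2
  refine (abs_currentDensity_le hv x y).trans ?_
  have hx' : |x| ≤ |l| + 1 := by
    have h1 : |x - l| < 1 := by simpa [Real.dist_eq] using hx
    have h2 := abs_sub_abs_le_abs_sub x l
    linarith
  have := (crossPhi_pos hv y).le
  gcongr

lemma strictMono_currentDensity (y : ℝ) : StrictMono fun l => currentDensity v l y := by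
  intro a b hab
  have hq := crossPhi_pos hv y
  have hq1 := crossPhi_lt_one hv y
  have ha := expZ_pos hv a y
  have hb := expZ_pos hv b y
  have hqq : 0 < crossPhi v y * (1 - crossPhi v y) := mul_pos hq (by linarith)
  simp only [currentDensity]
  by_cases hy : 0 < y
  · have he : Real.exp a < Real.exp b := Real.exp_lt_exp.2 hab
    simp only [expZ, sideReal, if_pos hy, mul_one, one_mul] at ha hb ⊢
    rw [div_lt_div_iff₀ ha hb]
    nlinarith
  · have he : Real.exp (-b) < Real.exp (-a) := Real.exp_lt_exp.2 (by linarith)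
    simp only [expZ, sideReal, if_neg hy, mul_neg, mul_one, neg_one_mul] at ha hb ⊢
    rw [neg_lt_neg_iff, div_lt_div_iff₀ hb ha]
    nlinarith

/-! ### The tilted mean current as a bijection of the line -/

lemma strictMono_tiltedCurrent : StrictMono (tiltedCurrent v) := by
  intro a b hab
  have hpos : ∀ y, 0 < currentDensity v b y - currentDensity v a y := fun y =>
    sub_pos.2 (strictMono_currentDensity hv y hab)
  have hia := integrable_currentDensity hv a
  have hib := integrable_currentDensity hv b
  rw [tiltedCurrent_eq_integral hv, tiltedCurrent_eq_integral hv, ← sub_pos, ← integral_sub hib hia,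
    integral_pos_iff_support_of_nonneg (fun y => (hpos y).le) (hib.sub hia)]
  have : Function.support (fun y => currentDensity v b y - currentDensity v a y) = univ :=
    eq_univ_of_forall fun y => (hpos y).ne'
  rw [this]
  simp

lemma Ftilt_neg_neg (a y : ℝ) : Ftilt v (-a) (-y) = 1 - Ftilt v a y := by
  rw [one_sub_Ftilt_eq hv, Ftilt, Phi_neg hv, neg_neg, sub_sub_cancel]

/-- Gaussian symmetry exchanges the two half-lines, so unboundedness above gives unboundedness
below. -/
lemma tiltedCurrent_neg (a : ℝ) : tiltedCurrent v (-a) = -tiltedCurrent v a := by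
  have h1 : ∀ b, ∫ y in Iic (0 : ℝ), Ftilt v (-b) y = ∫ y in Ioi (0 : ℝ), (1 - Ftilt v b y) := by
    intro b
    have := integral_comp_neg_Ioi 0 (Ftilt v (-b))
    rw [neg_zero] at this
    rw [← this]
    simp_rw [Ftilt_neg_neg hv]
  have h2 := h1 (-a)
  rw [neg_neg] at h2
  rw [tiltedCurrent, tiltedCurrent, h1, ← h2]
  ring

/-- Tilting by `e^{-a} = 1 - Φ(R)` makes `F_a ≤ 1/2` on `(0, R]`, so the right integral is at least
`R / 2 = |x| + |J|`. Since `a ≥ 0`, the left integral is at most its value `J` at zero tilt. -/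
lemma exists_le_tiltedCurrent (x : ℝ) : ∃ a, x ≤ tiltedCurrent v a := by
  set J : ℝ := ∫ y in Iic (0 : ℝ), Ftilt v 0 y with hJ
  set R : ℝ := 2 * (|x| + |J|)
  have hR : 0 ≤ R := by positivity
  have ht : 0 < 1 - Phi v R := sub_pos.2 (Phi_lt_one hv R)
  have ht1 : 1 - Phi v R ≤ 1 := by linarith [Phi_pos hv R]
  refine ⟨-Real.log (1 - Phi v R), ?_⟩
  set a := -Real.log (1 - Phi v R) with ha
  have ha0 : 0 ≤ a := neg_nonneg.2 (Real.log_nonpos ht.le ht1)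
  have hea : Real.exp (-a) = 1 - Phi v R := by rw [ha, neg_neg, Real.exp_log ht]
  have hleft : ∫ y in Iic (0 : ℝ), Ftilt v a y ≤ J := by
    refine setIntegral_mono_on (integrableOn_Ftilt hv a) (integrableOn_Ftilt hv 0)
      measurableSet_Iic fun y hy => ?_
    have h1 := (strictMono_currentDensity hv y).monotone ha0
    simp only [currentDensity_of_nonpos hy] at h1
    linarith
  have hnonneg : ∀ y, 0 ≤ 1 - Ftilt v a y := fun y => by
    have h0 := Phi_pos hv y
    have h1 := Phi_lt_one hv y
    rw [Ftilt, sub_nonneg]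
    refine div_le_one_of_le₀ ?_ ?_
    · linarith
    · have := mul_pos (Real.exp_pos (-a)) h0; linarith
  have hright : R / 2 ≤ ∫ y in Ioi (0 : ℝ), (1 - Ftilt v a y) := by
    have hsub : ∫ y in Ioc (0 : ℝ) R, (1 - Ftilt v a y) ≤ ∫ y in Ioi (0 : ℝ), (1 - Ftilt v a y) :=
      setIntegral_mono_set (integrableOn_one_sub_Ftilt hv a) (ae_of_all _ hnonneg)
        Ioc_subset_Ioi_self.eventuallyLE
    refine le_trans ?_ hsub
    have hconst : ∫ _ in Ioc (0 : ℝ) R, (1 / 2 : ℝ) = R / 2 := by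
      rw [setIntegral_const, measureReal_def, Real.volume_Ioc, sub_zero, ENNReal.toReal_ofReal hR,
        smul_eq_mul]
      ring
    rw [← hconst]
    refine setIntegral_mono_on (integrableOn_const (by simp))
      ((integrableOn_one_sub_Ftilt hv a).mono_set Ioc_subset_Ioi_self) measurableSet_Ioc
      fun y hy => ?_
    have h0 := Phi_pos hv y
    have h1 := Phi_lt_one hv y
    have h2 := monotone_Phi v hy.2
    have h3 : Ftilt v a y ≤ 1 / 2 := by
      rw [Ftilt, hea, div_le_div_iff₀ (by nlinarith) (by norm_num)]
      nlinarith
    linarith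
  rw [tiltedCurrent]
  have h1 := le_abs_self x
  have h2 := le_abs_self J
  have h3 : R / 2 = |x| + |J| := by simp only [R]; ring
  linarith

lemma surjective_tiltedCurrent : Function.Surjective (tiltedCurrent v) := by
  intro x
  -- Darboux's theorem: `tiltedCurrent` is a derivative, so its range is an interval without any
  -- appeal to its continuity.
  have hconn : (tiltedCurrent v '' univ).OrdConnected := ordConnected_univ.image_hasDerivWithinAt
    fun l _ => (hasDerivAt_Lam_dirac_one hv l).hasDerivWithinAt
  obtain ⟨a, ha⟩ := exists_le_tiltedCurrent hv x
  obtain ⟨b, hb⟩ := exists_le_tiltedCurrent hv (-x)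
  have hb' : tiltedCurrent v (-b) ≤ x := by rw [tiltedCurrent_neg hv]; linarith
  obtain ⟨l, -, hl⟩ := hconn.out (mem_image_of_mem _ (mem_univ (-b)))
    (mem_image_of_mem _ (mem_univ a)) ⟨hb', ha⟩
  exact ⟨l, hl⟩

/-! ### Relative entropy as the Legendre transform -/

lemma entropyDensity_eq (a y : ℝ) :
    entropyDensity v a y = a * currentDensity v a y - Real.log (expZ v a y) := by
  have h0 := Phi_pos hv y
  have h1 : 0 < 1 - Phi v y := sub_pos.2 (Phi_lt_one hv y)
  have hE := Real.exp_pos a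
  have hE' := Real.exp_pos (-a)
  have hD : 0 < 1 - Phi v y + Real.exp (-a) * Phi v y := by
    have := mul_pos hE' h0; linarith
  have hF : 1 - Ftilt v a y = (1 - Phi v y) / (1 - Phi v y + Real.exp (-a) * Phi v y) := by
    rw [Ftilt]; field_simp; ring
  have hr1 : (1 - Ftilt v a y) / (1 - Phi v y)
      = (1 - Phi v y + Real.exp (-a) * Phi v y)⁻¹ := by
    rw [hF]; field_simp
  have hr2 : Ftilt v a y / Phi v y
      = Real.exp (-a) * (1 - Phi v y + Real.exp (-a) * Phi v y)⁻¹ := by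
    rw [Ftilt]; field_simp
  -- With `D = 1 - Φ + e^{-a} Φ`, the two log-ratios are `-log D` and `-a - log D`, weighted by `1 -
  -- F` and `F`. For `y > 0` one has `expZ = e^a D`, and the extra `a` turns `-F` into `1 - F`.
  have hlog : entropyDensity v a y
      = -a * Ftilt v a y - Real.log (1 - Phi v y + Real.exp (-a) * Phi v y) := by
    rw [entropyDensity, hr1, hr2, Real.log_mul hE'.ne' (inv_pos.2 hD).ne', Real.log_exp,
      Real.log_inv]
    ring
  rw [hlog]
  rcases lt_or_ge 0 y with hy | hy
  · have hZ : expZ v a y = Real.exp a * (1 - Phi v y + Real.exp (-a) * Phi v y) := by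
      have hee : Real.exp a * Real.exp (-a) = 1 := by rw [← Real.exp_add]; simp
      simp only [expZ, sideReal, crossPhi, if_pos hy, mul_one]
      linear_combination (-Phi v y) * hee
    rw [currentDensity_of_pos hv hy, hZ, Real.log_mul hE.ne' hD.ne', Real.log_exp]
    ring
  · have hZ : expZ v a y = 1 - Phi v y + Real.exp (-a) * Phi v y := by
      simp only [expZ, sideReal, crossPhi, if_neg (not_lt.2 hy), mul_neg, mul_one]
      ring
    rw [currentDensity_of_nonpos hy, hZ]
    ring

lemma integrable_log_expZ (a : ℝ) : Integrable fun y => Real.log (expZ v a y) := by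
  have := isLogPGF_dirac_one.integrable_gam_Zfun hv a
  simp_rw [isLogPGF_dirac_one.gam_Zfun hv] at this
  exact this

lemma integrable_entropyDensity (a : ℝ) : Integrable fun y => entropyDensity v a y := by
  simp_rw [entropyDensity_eq hv]
  exact ((integrable_currentDensity hv a).const_mul a).sub (integrable_log_expZ hv a)

lemma integral_entropyDensity (a : ℝ) :
    ∫ y, entropyDensity v a y = a * tiltedCurrent v a - Lam (Measure.dirac 1) v a := by
  simp_rw [entropyDensity_eq hv]
  rw [integral_sub ((integrable_currentDensity hv a).const_mul a) (integrable_log_expZ hv a),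
    integral_const_mul, tiltedCurrent_eq_integral hv, Lam]
  simp_rw [isLogPGF_dirac_one.gam_Zfun hv]

end

end WalkCurrent

/-! ### Assembly of the two cases -/

theorem corollary2p2
    {Ω : ℕ → Type*} [∀ n, MeasurableSpace (Ω n)]
    (P : ∀ n, Measure (Ω n)) [∀ n, IsProbabilityMeasure (P n)]
    (p : PMF ℤ) (hp : WalkCurrent.HasExpMoments p) (hκ : 0 < WalkCurrent.secondMoment p)
    (η : ∀ n, ℤ → Ω n → ℕ) (ξ : ∀ n, ℤ × ℕ → ℝ≥0 → Ω n → ℤ)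
    (t : ℝ≥0) (ht : 0 < t) (r : ℝ) :
    -- Poisson occupations
    (∀ ρ : ℝ≥0, 0 < ρ →
      (∀ n, 1 ≤ n → WalkCurrent.IsWalkSystem p (poissonMeasure ρ) (P n) (η n) (ξ n)) →
      WalkCurrent.IsCurrentRate p (poissonMeasure ρ) P η ξ t r
        (WalkCurrent.poissonRate ρ (WalkCurrent.secondMoment p * t))) ∧
    -- deterministic occupations, one particle per site
    ((∀ n, 1 ≤ n → WalkCurrent.IsWalkSystem p (Measure.dirac 1) (P n) (η n) (ξ n)) →
      -- the integrals in the current constraint converge and the constraint has a unique solution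
      (∀ a : ℝ,
        IntegrableOn (fun y => 1 - WalkCurrent.Ftilt (WalkCurrent.secondMoment p * t) a y)
          (Ioi 0) ∧
        IntegrableOn (fun y => WalkCurrent.Ftilt (WalkCurrent.secondMoment p * t) a y)
          (Iic 0)) ∧
      (∀ x : ℝ, ∃! a : ℝ, x = WalkCurrent.tiltedCurrent (WalkCurrent.secondMoment p * t) a) ∧
      -- the rate function is the relative entropy integral
      ∀ α : ℝ → ℝ,
        (∀ x : ℝ, x = WalkCurrent.tiltedCurrent (WalkCurrent.secondMoment p * t) (α x)) →
        (∀ x : ℝ, Integrable fun y =>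
          WalkCurrent.entropyDensity (WalkCurrent.secondMoment p * t) (α x) y) ∧
        WalkCurrent.IsCurrentRate p (Measure.dirac 1) P η ξ t r
          (fun x => ∫ y : ℝ,
            WalkCurrent.entropyDensity (WalkCurrent.secondMoment p * t) (α x) y)) := by
  have hv : 0 < WalkCurrent.secondMoment p * t := mul_pos hκ ht
  refine ⟨fun ρ hρ hsys => ?_, fun hsys => ⟨fun a => ⟨WalkCurrent.integrableOn_one_sub_Ftilt hv a,
    WalkCurrent.integrableOn_Ftilt hv a⟩, fun x => ?_, fun α hα =>
    ⟨fun x => WalkCurrent.integrable_entropyDensity hv (α x), ?_⟩⟩⟩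
  · have hρ' : (0 : ℝ) < ρ := hρ
    have hK : 0 < ρ * √(2 * (WalkCurrent.secondMoment p * t) / Real.pi) :=
      mul_pos hρ' (Real.sqrt_pos.2 (div_pos (by linarith) Real.pi_pos))
    have hLam := funext (WalkCurrent.Lam_poissonMeasure ρ hv)
    refine WalkCurrent.isCurrentRate_of_deriv hκ ht r (WalkCurrent.isLogPGF_poissonMeasure ρ) hsys
      (L' := fun l => ρ * √(2 * (WalkCurrent.secondMoment p * t) / Real.pi) * Real.sinh l)
      (fun l => ?_) (fun a b hab => ?_) (fun x => ?_) (fun l => ?_)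
    · rw [hLam]
      exact ((Real.hasDerivAt_cosh l).sub_const 1).const_mul _
    · exact mul_le_mul_of_nonneg_left (Real.sinh_le_sinh.2 hab) hK.le
    · obtain ⟨l, hl⟩ := Real.sinh_surjective
        (x / (ρ * √(2 * (WalkCurrent.secondMoment p * t) / Real.pi)))
      exact ⟨l, by simp only [hl]; field_simp⟩
    · rw [hLam, WalkCurrent.poissonRate_mul_sinh hρ' hv]
  · obtain ⟨a, ha⟩ := WalkCurrent.surjective_tiltedCurrent hv x
    exact ⟨a, ha.symm, fun b hb =>
      (WalkCurrent.strictMono_tiltedCurrent hv).injective (hb.symm.trans ha.symm)⟩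
  · have hinj := (WalkCurrent.strictMono_tiltedCurrent hv).injective
    refine WalkCurrent.isCurrentRate_of_deriv hκ ht r WalkCurrent.isLogPGF_dirac_one hsys
      (WalkCurrent.hasDerivAt_Lam_dirac_one hv) (WalkCurrent.strictMono_tiltedCurrent hv).monotone
      (WalkCurrent.surjective_tiltedCurrent hv) fun l => ?_
    -- By injectivity, any choice of solutions `α` is the inverse of the tilted current, so at `x =
    -- Λ'(l)` it recovers the tilt `l`.
    have : α (WalkCurrent.tiltedCurrent (WalkCurrent.secondMoment p * t) l) = l :=
      hinj (hα _).symm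
    rw [this, WalkCurrent.integral_entropyDensity hv]
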